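/- Let $S\subseteq\mathbb R$ be a non-degenerate interval and let $X=(X_t)_{t\ge 0}$ be a time-homogeneous diffusion on $S$, that is, a Markov process with continuous paths whose generator in the interior of $S$ is $\mathcal A=\mu(x)\frac{d}{dx}+\frac12\sigma^2(x)\frac{d^2}{dx^2}$ with measurable, locally bounded $\mu$ and $\sigma^2$. Write $\mathbb P_x$ for its law when started at $x\in S$, and $P^t(x,dy)$ for its transition kernels, $P^tf(x)=\int f(y)\,P^t(x,dy)$. Suppose that $X$ is uniformly ergodic: it has a stationary probability distribution $\pi$, and there are constants $C<\infty$ and $\beta>0$ such that for all $t\ge 0$ $$\sup_{x\in S}\ \sup_{A}\ |P^t(x,A)-\pi(A)|\le Ce^{-\beta t},$$ where $A$ ranges over the Borel subsets of $S$. For bounded measurable $f:S\to\mathbb R$ put $\pi(f)=\int_S f\,d\pi$ and $\|f\|=\sup_{x\in S}|f(x)|$, and let $Q^\sharp$ be the deviation kernel of $X$, $$Q^\sharp f(x)=\int_0^\infty\bigl(P^tf(x)-\pi(f)\bigr)\,dt,\qquad \|Q^\sharp\|=\sup_{\|f\|\le 1}\|Q^\sharp f\|.$$ Then for every bounded measurable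 $f:S\to\mathbb R$, every $\varepsilon>0$, every $t>\frac{2\|f\|\,\|Q^\sharp\|}{\varepsilon}$ and every $x\in S$, $$\mathbb P_x\left(\frac1t\int_0^t f(X_s)\,ds-\pi(f)\ge\varepsilon\right)\le\exp\left\{\frac{-2\bigl(t\varepsilon-2\|f\|\,\|Q^\sharp\|\bigr)^2}{(t+1)\,\|f\|^2\,\bigl(2\|Q^\sharp\|+1\bigr)^2}\right\}$$ (for $f=0$ the right-hand side is read as $1$). -/

import Mathlib

open MeasureTheory ProbabilityTheory
open scoped NNReal

noncomputable section

/-- The differential operator `φ ↦ μ φ' + (1/2) σ² φ''`. -/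
def diffusionGenerator (μ σ : ℝ → ℝ) (φ : ℝ → ℝ) (x : ℝ) : ℝ :=
  μ x * deriv φ x + (1 / 2) * σ x ^ 2 * deriv (deriv φ) x

/-- A time-homogeneous one-dimensional diffusion on the state space `S`, an interval of the line,
given as a Markov family `(X, ℱ, (ℙ_x)_{x ∈ S})` with continuous paths which, inside `S`, has
generator `μ d/dx + (1/2) σ² d²/dx²` (in the sense of the martingale problem for `C²` functions
with compact support in the interior of `S`, so that any boundary behaviour is allowed). -/
structure Diffusion (S : Set ℝ) (Ω : Type*) [MeasurableSpace Ω] where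
  /-- The state space is an interval (open, half-open or closed, bounded or not). -/
  ordConnected : S.OrdConnected
  /-- The interval is not degenerate. -/
  nonempty_interior : (interior S).Nonempty
  /-- The drift coefficient `μ`. -/
  drift : ℝ → ℝ
  /-- A square root `σ` of the diffusion coefficient `σ²`. -/
  vol : ℝ → ℝ
  measurable_drift : Measurable drift
  measurable_vol : Measurable vol
  locally_bounded : ∀ K : Set ℝ, K ⊆ interior S → IsCompact K →
    ∃ C : ℝ, ∀ x ∈ K, |drift x| ≤ C ∧ vol x ^ 2 ≤ C
  /-- The process. -/
  X : ℝ≥0 → Ω → S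
  /-- The filtration. -/
  ℱ : Filtration ℝ≥0 (inferInstance : MeasurableSpace Ω)
  /-- The law `ℙ_x` under which the process starts at `x`. -/
  law : S → Measure Ω
  isProbabilityMeasure_law : ∀ x, IsProbabilityMeasure (law x)
  /-- The transition kernels `P^t(x, dy)`. -/
  P : ℝ≥0 → Kernel S S
  isMarkovKernel : ∀ t, IsMarkovKernel (P t)
  adapted : ∀ t, Measurable[ℱ t] (X t)
  continuous_paths : ∀ ω, Continuous fun t => X t ω
  initial : ∀ x, ∀ᵐ ω ∂(law x), X 0 ω = x
  /-- The Markov property: `ℙ_x (X_{s+t} ∈ A | ℱ_s) = P^t(X_s, A)` almost surely. -/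
  markov : ∀ (x : S) (s t : ℝ≥0) (A : Set S), MeasurableSet A →
    (law x)[(X (s + t) ⁻¹' A).indicator (fun _ => (1 : ℝ)) | ℱ s]
      =ᵐ[law x] fun ω => (P t (X s ω)).real A
  /-- `X` solves the martingale problem of its generator in the interior of `S`. -/
  martingale : ∀ (x : S) (φ : ℝ → ℝ), ContDiff ℝ 2 φ → HasCompactSupport φ →
    tsupport φ ⊆ interior S →
    Martingale (fun (t : ℝ≥0) ω => φ (X t ω) - φ (X 0 ω)
      - ∫ s in (0 : ℝ)..t, diffusionGenerator drift vol φ (X s.toNNReal ω)) ℱ (law x)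

/-- The total variation distance `sup_A |μ(A) - ν(A)|` of two probability measures. -/
def tvDist {E : Type*} [MeasurableSpace E] (μ ν : Measure E) : ℝ :=
  ⨆ A : {A : Set E // MeasurableSet A}, |μ.real A - ν.real A|

/-- The supremum norm `sup_x |f x|` of a bounded function. -/
def supNorm {E : Type*} (f : E → ℝ) : ℝ := ⨆ x, |f x|

namespace Diffusion

variable {S : Set ℝ} {Ω : Type*} [MeasurableSpace Ω]

/-- `X` is uniformly ergodic with stationary distribution `π`: the probability measure `π` is
invariant, and `sup_x ‖P^t(x, ·) - π‖_TV ≤ C e^{-β t}` for some `C < ∞`, `β > 0` and all `t ≥ 0`. -/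
structure IsUniformlyErgodic (D : Diffusion S Ω) (π : Measure S) : Prop where
  isProbabilityMeasure : IsProbabilityMeasure π
  invariant : ∀ t, (D.P t).Invariant π
  decay : ∃ C β : ℝ, 0 < β ∧ ∀ (t : ℝ≥0) (x : S), tvDist (D.P t x) π ≤ C * Real.exp (-β * t)

/-- The deviation kernel `Q♯ f (x) = ∫₀^∞ (P^t f (x) - π f) dt`. -/
def deviation (D : Diffusion S Ω) (π : Measure S) (f : S → ℝ) (x : S) : ℝ :=
  ∫ t in Set.Ioi (0 : ℝ), ((∫ y, f y ∂(D.P t.toNNReal x)) - ∫ y, f y ∂π)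

/-- The operator norm `‖Q♯‖ = sup {‖Q♯ f‖ : ‖f‖ ≤ 1}` on bounded measurable functions. -/
def deviationNorm (D : Diffusion S Ω) (π : Measure S) : ℝ :=
  sSup {r | ∃ f : S → ℝ, Measurable f ∧ (∀ x, |f x| ≤ 1) ∧ r = supNorm (D.deviation π f)}

end Diffusion

end

/-! Take ‖f‖ ≤ 1 and write m = π(f), Q = ‖Q♯‖, g = Q♯f. The function g solves the Poisson equation
𝒜g = -(f - m) in the integrated form g = ∫₀ˢ (P^t f - m) dt + P^s g
(`deviation_eq_add_semigroup_deviation`). For a constant k making u = g + k positive, the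
Feynman–Kac identity `integral_mul_exp_eq` then reads 𝔼_x[u(X_t) exp ∫₀ᵗ ((f - m)/u)(X_s) ds] =
u(x). With k chosen so that 1/u stays near θ, the inequality θ(f - m) ≤ Qθ² + (f - m)/u holds
pointwise (`mul_le_of_quadratic_bounds`). Markov's inequality bounds the probability of ∫₀ᵗ (f -
m)(X_s) ds ≥ R by (hi/lo) exp(Qθ²t - θR), where lo ≤ u ≤ hi.

The target is the minimum over θ of exp(-θ(tε - 2Q) + θ²(t+1)(2Q+1)²/8). With r = Qθ and R = tε it
therefore suffices that hi/lo ≤ exp(2r + O(r²)) and that the quadratic term absorbs the remainder;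
the room comes from (2Q+1)² = (2Q-1)² + 8Q. Using only |g| ≤ Q, the ratio degenerates when m is
close to -1. But then f ≥ -1 lies barely below its mean, and `neg_le_deviation` improves the lower
bound on g. -/

noncomputable section

/-! ### The Markov property and the transition semigroup -/

/-- Integrals of bounded measurable functions against a bounded measure exist. -/
theorem integrable_of_measurable_of_abs_le {α : Type*} [MeasurableSpace α] {μ : Measure α}
    [IsFiniteMeasure μ] {f : α → ℝ} (hf : Measurable f) {B : ℝ} (hB : ∀ x, |f x| ≤ B) :
    Integrable f μ :=
  Integrable.of_bound hf.aestronglyMeasurable B (Filter.Eventually.of_forall hB)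

theorem abs_integral_le_of_abs_le {α : Type*} [MeasurableSpace α] {μ : Measure α}
    [IsProbabilityMeasure μ] {f : α → ℝ} {B : ℝ} (hB : ∀ x, |f x| ≤ B) :
    |∫ x, f x ∂μ| ≤ B := by
  have h := norm_integral_le_of_norm_le_const (μ := μ) (f := f) (C := B)
    (Filter.Eventually.of_forall hB)
  simpa using h

theorem integral_bind_kernel {α β : Type*} [MeasurableSpace α] [MeasurableSpace β]
    (μ : Measure α) [IsFiniteMeasure μ] (κ : Kernel α β) [IsMarkovKernel κ] {f : β → ℝ}
    (hf : Measurable f) {B : ℝ} (hB : ∀ x, |f x| ≤ B) :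
    ∫ y, f y ∂(μ.bind κ) = ∫ x, ∫ y, f y ∂(κ x) ∂μ := by
  rw [Measure.comp_eq_comp_const_apply, Kernel.integral_comp]
  · simp
  · exact integrable_of_measurable_of_abs_le hf hB

namespace Diffusion

variable {S : Set ℝ} {Ω : Type*} [MeasurableSpace Ω]

attribute [instance] Diffusion.isProbabilityMeasure_law Diffusion.isMarkovKernel

theorem measurable_X (D : Diffusion S Ω) (t : ℝ≥0) : Measurable (D.X t) :=
  (D.adapted t).mono (D.ℱ.le t) le_rfl

theorem measurable_uncurry_X (D : Diffusion S Ω) :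
    Measurable fun p : ℝ≥0 × Ω => D.X p.1 p.2 :=
  measurable_uncurry_of_continuous_of_measurable (u := D.X) D.continuous_paths D.measurable_X

/-- The Markov property, as an identity of measures. -/
theorem map_restrict_X_add (D : Diffusion S Ω) (x : S) (s t : ℝ≥0) {B : Set Ω}
    (hB : MeasurableSet[D.ℱ s] B) :
    ((D.law x).restrict B).map (D.X (s + t))
      = (((D.law x).restrict B).map (D.X s)).bind (D.P t) := by
  have hB' := D.ℱ.le s B hB
  ext A hA
  have hXA : MeasurableSet (D.X (s + t) ⁻¹' A) := D.measurable_X _ hA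
  have h1 : ∫ ω in B, (D.X (s + t) ⁻¹' A).indicator (fun _ => (1 : ℝ)) ω ∂(D.law x)
      = ∫ ω in B, (D.P t (D.X s ω)).real A ∂(D.law x) := by
    rw [← setIntegral_condExp (D.ℱ.le s) ((integrable_const 1).indicator hXA) hB]
    exact integral_congr_ae (ae_restrict_of_ae (D.markov x s t A hA))
  rw [integral_indicator_const _ hXA] at h1
  rw [Measure.map_apply (D.measurable_X _) hA, Measure.bind_apply hA (Kernel.aemeasurable _),
    lintegral_map (Kernel.measurable_coe _ hA) (D.measurable_X _)]
  have hm : Measurable fun ω => (D.P t (D.X s ω)).real A :=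
    ((Kernel.measurable_coe _ hA).comp (D.measurable_X _)).ennreal_toReal
  have h2 : ∫⁻ ω in B, (D.P t (D.X s ω)) A ∂(D.law x)
      = ENNReal.ofReal (∫ ω in B, (D.P t (D.X s ω)).real A ∂(D.law x)) := by
    rw [ofReal_integral_eq_lintegral_ofReal]
    · simp
    · refine integrable_of_measurable_of_abs_le hm (B := 1) fun ω => ?_
      rw [abs_of_nonneg measureReal_nonneg]
      exact measureReal_le_one
    · exact Filter.Eventually.of_forall fun ω => measureReal_nonneg
  rw [h2, ← h1]
  simp

theorem map_X (D : Diffusion S Ω) (x : S) (t : ℝ≥0) :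
    (D.law x).map (D.X t) = D.P t x := by
  have h := D.map_restrict_X_add x 0 t MeasurableSet.univ
  have h0 : (D.law x).map (D.X 0) = Measure.dirac x := by
    rw [Measure.map_congr (D.initial x), Measure.map_const]
    simp
  rw [Measure.restrict_univ, h0, Measure.dirac_bind (Kernel.measurable _), zero_add] at h
  exact h

theorem bind_P (D : Diffusion S Ω) (x : S) (s t : ℝ≥0) :
    (D.P s x).bind (D.P t) = D.P (s + t) x := by
  have h := D.map_restrict_X_add x s t MeasurableSet.univ
  rw [Measure.restrict_univ, D.map_X, D.map_X] at h
  exact h.symm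

theorem integral_P_eq (D : Diffusion S Ω) (x : S) (t : ℝ≥0) {f : S → ℝ} (hf : Measurable f) :
    ∫ y, f y ∂(D.P t x) = ∫ ω, f (D.X t ω) ∂(D.law x) := by
  rw [← D.map_X, integral_map (D.measurable_X t).aemeasurable hf.aestronglyMeasurable]

/-- The transition probabilities depend measurably on time and starting point jointly. -/
theorem measurable_uncurry_P (D : Diffusion S Ω) :
    Measurable fun p : ℝ≥0 × S => D.P p.1 p.2 := by
  -- For continuous `c` the integral is 𝔼_x c(X_t), continuous in t by path continuity and
  -- measurable in x, hence jointly measurable. Thickened indicators carry this over to closed sets,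
  -- a π-system generating the Borel sets.
  have hc : ∀ c : BoundedContinuousFunction S ℝ≥0,
      Measurable fun p : ℝ≥0 × S => ∫ y, (c y : ℝ) ∂(D.P p.1 p.2) := by
    intro c
    have hcm : Measurable fun y => (c y : ℝ) := c.continuous.measurable.coe_nnreal_real
    refine measurable_uncurry_of_continuous_of_measurable
      (u := fun t x => ∫ y, (c y : ℝ) ∂(D.P t x)) (fun x => ?_) (fun t => ?_)
    · simp_rw [D.integral_P_eq x _ hcm]
      refine continuous_of_dominated (bound := fun _ => (nndist c 0 : ℝ))
        (fun t => (hcm.comp (D.measurable_X t)).aestronglyMeasurable) (fun t => ?_)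
        (integrable_const _) ?_
      · refine Filter.Eventually.of_forall fun ω => ?_
        rw [Real.norm_of_nonneg (NNReal.coe_nonneg _)]
        exact_mod_cast BoundedContinuousFunction.NNReal.upper_bound c _
      · exact Filter.Eventually.of_forall fun ω =>
          NNReal.continuous_coe.comp (c.continuous.comp (D.continuous_paths ω))
    · exact hcm.stronglyMeasurable.integral_kernel.measurable
  refine Measurable.measure_of_isPiSystem_of_isProbabilityMeasure (S := {F : Set S | IsClosed F})
    ?_ isPiSystem_isClosed ?_
  · rw [← borel_eq_generateFrom_isClosed]; exact BorelSpace.measurable_eq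
  intro F hF
  have hδ : ∀ n : ℕ, (0 : ℝ) < 1 / ((n : ℝ) + 1) := fun n => by positivity
  have hr : Measurable fun p : ℝ≥0 × S => (D.P p.1 p.2).real F := by
    refine measurable_of_tendsto_metrizable (fun n => hc (thickenedIndicator (hδ n) F)) ?_
    rw [tendsto_pi_nhds]
    intro p
    exact tendsto_integral_thickenedIndicator_of_isClosed _ hF hδ
      tendsto_one_div_add_atTop_nhds_zero_nat
  have := hr.ennreal_ofReal
  simpa using this

/-- The transition kernels as one kernel from time and starting point. -/
def jointKernel (D : Diffusion S Ω) : Kernel (ℝ≥0 × S) S where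
  toFun p := D.P p.1 p.2
  measurable' := D.measurable_uncurry_P

/-- The transition semigroup `P^t f (x)`, with real time. -/
def semigroup (D : Diffusion S Ω) (f : S → ℝ) (t : ℝ) (x : S) : ℝ :=
  ∫ y, f y ∂(D.P t.toNNReal x)

theorem measurable_uncurry_semigroup (D : Diffusion S Ω) {f : S → ℝ} (hf : Measurable f) :
    Measurable fun p : ℝ × S => D.semigroup f p.1 p.2 := by
  have h : StronglyMeasurable fun p : ℝ≥0 × S => ∫ y, f y ∂(D.jointKernel p) :=
    hf.stronglyMeasurable.integral_kernel
  exact h.measurable.comp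
    ((measurable_real_toNNReal.comp measurable_fst).prodMk measurable_snd)

theorem abs_semigroup_le (D : Diffusion S Ω) {f : S → ℝ} {B : ℝ} (hB : ∀ x, |f x| ≤ B)
    (t : ℝ) (x : S) : |D.semigroup f t x| ≤ B :=
  abs_integral_le_of_abs_le hB

theorem semigroup_eq (D : Diffusion S Ω) {f : S → ℝ} (hf : Measurable f) (t : ℝ) (x : S) :
    D.semigroup f t x = ∫ ω, f (D.X t.toNNReal ω) ∂(D.law x) :=
  D.integral_P_eq x _ hf

theorem semigroup_semigroup (D : Diffusion S Ω) {f : S → ℝ} (hf : Measurable f) {B : ℝ}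
    (hB : ∀ x, |f x| ≤ B) {s t : ℝ} (hs : 0 ≤ s) (ht : 0 ≤ t) (x : S) :
    D.semigroup (D.semigroup f t) s x = D.semigroup f (s + t) x := by
  unfold semigroup
  rw [← integral_bind_kernel _ _ hf hB, D.bind_P, Real.toNNReal_add hs ht]

theorem semigroup_add_const (D : Diffusion S Ω) {f : S → ℝ} (hf : Measurable f) {B : ℝ}
    (hB : ∀ x, |f x| ≤ B) (c t : ℝ) (x : S) :
    D.semigroup (fun y => f y + c) t x = D.semigroup f t x + c := by
  unfold semigroup
  rw [integral_add (integrable_of_measurable_of_abs_le hf hB) (integrable_const c)]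
  simp

theorem semigroup_sub_const (D : Diffusion S Ω) {f : S → ℝ} (hf : Measurable f) {B : ℝ}
    (hB : ∀ x, |f x| ≤ B) (c t : ℝ) (x : S) :
    D.semigroup (fun y => f y - c) t x = D.semigroup f t x - c := by
  simpa [sub_eq_add_neg] using D.semigroup_add_const hf hB (-c) t x

/-- The Markov property for bounded functions, tested against a bounded variable that is
measurable with respect to the past. -/
theorem integral_mul_comp_X (D : Diffusion S Ω) (x : S) {s t : ℝ} (hs : 0 ≤ s) (hst : s ≤ t)
    {ξ : Ω → ℝ} (hξ : Measurable[D.ℱ s.toNNReal] ξ) {K : ℝ} (hK : ∀ ω, |ξ ω| ≤ K)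
    {f : S → ℝ} (hf : Measurable f) {B : ℝ} (hB : ∀ x, |f x| ≤ B) :
    ∫ ω, ξ ω * f (D.X t.toNNReal ω) ∂(D.law x)
      = ∫ ω, ξ ω * D.semigroup f (t - s) (D.X s.toNNReal ω) ∂(D.law x) := by
  obtain ⟨h, hh, rfl⟩ : ∃ h : ℝ, 0 ≤ h ∧ t = s + h := ⟨t - s, sub_nonneg.2 hst, by ring⟩
  rw [add_sub_cancel_left, Real.toNNReal_add hs hh]
  set s' := s.toNNReal
  have hPm : Measurable (D.semigroup f h) :=
    (D.measurable_uncurry_semigroup hf).comp measurable_prodMk_left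
  have hi : Integrable (fun ω => f (D.X (s' + h.toNNReal) ω)) (D.law x) :=
    integrable_of_measurable_of_abs_le (hf.comp (D.measurable_X _)) fun ω => hB _
  have hg : Measurable[D.ℱ s'] fun ω => D.semigroup f h (D.X s' ω) := hPm.comp (D.adapted s')
  have hce : (fun ω => D.semigroup f h (D.X s' ω))
      =ᵐ[D.law x] (D.law x)[fun ω => f (D.X (s' + h.toNNReal) ω) | D.ℱ s'] := by
    refine ae_eq_condExp_of_forall_setIntegral_eq (D.ℱ.le s') hi (fun A _ _ => ?_)
      (fun A hA _ => ?_) hg.stronglyMeasurable.aestronglyMeasurable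
    · exact (integrable_of_measurable_of_abs_le (hg.mono (D.ℱ.le s') le_rfl)
        fun ω => D.abs_semigroup_le hB _ _).integrableOn
    · rw [← integral_map (φ := D.X s') (f := D.semigroup f h) (D.measurable_X _).aemeasurable
        hPm.aestronglyMeasurable, ← integral_map (φ := D.X (s' + h.toNNReal)) (f := f)
        (D.measurable_X _).aemeasurable hf.aestronglyMeasurable, D.map_restrict_X_add x s' _ hA,
        integral_bind_kernel _ _ hf hB]
      rfl
  have hpull := condExp_stronglyMeasurable_mul_of_bound (D.ℱ.le s') (μ := D.law x)
    hξ.stronglyMeasurable hi K (Filter.Eventually.of_forall hK)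
  calc ∫ ω, ξ ω * f (D.X (s' + h.toNNReal) ω) ∂(D.law x)
      = ∫ ω, ((D.law x)[ξ * (fun ω => f (D.X (s' + h.toNNReal) ω)) | D.ℱ s']) ω ∂(D.law x) :=
        (integral_condExp (D.ℱ.le s')).symm
    _ = _ := by
        refine integral_congr_ae ?_
        filter_upwards [hpull, hce] with ω h1 h2
        rw [h1, Pi.mul_apply, ← h2]

end Diffusion

/-! ### Total variation, the deviation kernel and its Poisson equation -/

theorem abs_measureReal_sub_le_tvDist {E : Type*} [MeasurableSpace E] (μ ν : Measure E)
    [IsProbabilityMeasure μ] [IsProbabilityMeasure ν] {A : Set E} (hA : MeasurableSet A) :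
    |μ.real A - ν.real A| ≤ tvDist μ ν := by
  refine le_ciSup (f := fun A : {A : Set E // MeasurableSet A} => |μ.real A - ν.real A|)
    ⟨1, ?_⟩ ⟨A, hA⟩
  rintro _ ⟨B, rfl⟩
  have h1 : μ.real B ≤ 1 := measureReal_le_one
  have h2 : ν.real B ≤ 1 := measureReal_le_one
  have h3 : 0 ≤ μ.real B := measureReal_nonneg
  have h4 : 0 ≤ ν.real B := measureReal_nonneg
  exact abs_le.2 ⟨by linarith, by linarith⟩

/-- Layer cake: f + B takes values in [0, 2B], so its mean is the integral over levels in (0, 2B] of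
the mass of a superlevel set, and at each level the two masses differ by at most the total variation
distance. -/
theorem abs_integral_sub_le_tvDist {E : Type*} [MeasurableSpace E] (μ ν : Measure E)
    [IsProbabilityMeasure μ] [IsProbabilityMeasure ν] {f : E → ℝ} (hf : Measurable f) {B : ℝ}
    (hB : ∀ x, |f x| ≤ B) :
    |∫ x, f x ∂μ - ∫ x, f x ∂ν| ≤ 2 * B * tvDist μ ν := by
  have hB0 : 0 ≤ B := by
    obtain ⟨x⟩ : Nonempty E := nonempty_of_isProbabilityMeasure μ
    exact (abs_nonneg _).trans (hB x)
  have hlayer : ∀ (ρ : Measure E) [IsProbabilityMeasure ρ],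
      ∫ x, f x ∂ρ + B = ∫ u in Set.Ioc 0 (2 * B), ρ.real {x | u ≤ f x + B} := by
    intro ρ _
    have hi : Integrable f ρ := integrable_of_measurable_of_abs_le hf hB
    have hi' : Integrable (fun x => f x + B) ρ := hi.add (integrable_const B)
    rw [← Integrable.integral_eq_integral_Ioc_meas_le hi']
    · rw [integral_add hi (integrable_const B)]
      simp
    · exact Filter.Eventually.of_forall fun x => by
        have := (abs_le.1 (hB x)).1
        simp only [Pi.zero_apply]
        linarith
    · exact Filter.Eventually.of_forall fun x => by
        have := (abs_le.1 (hB x)).2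
        linarith
  have hint : ∀ (ρ : Measure E) [IsProbabilityMeasure ρ],
      IntegrableOn (fun u => ρ.real {x | u ≤ f x + B}) (Set.Ioc 0 (2 * B)) := by
    intro ρ _
    have ha : Antitone fun u => ρ.real {x | u ≤ f x + B} := fun u v huv =>
      measureReal_mono fun x (hx : v ≤ f x + B) => huv.trans hx
    refine integrable_of_measurable_of_abs_le ha.measurable (B := 1) fun u => ?_
    rw [abs_of_nonneg measureReal_nonneg]
    exact measureReal_le_one
  have hdiff : ∫ x, f x ∂μ - ∫ x, f x ∂ν
      = ∫ u in Set.Ioc 0 (2 * B), (μ.real {x | u ≤ f x + B} - ν.real {x | u ≤ f x + B}) := by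
    rw [integral_sub (hint μ) (hint ν), ← hlayer μ, ← hlayer ν]
    ring
  rw [hdiff, ← Real.norm_eq_abs]
  refine (norm_setIntegral_le_of_norm_le_const (C := tvDist μ ν) measure_Ioc_lt_top fun u _ => ?_).trans ?_
  · exact abs_measureReal_sub_le_tvDist μ ν (measurableSet_le measurable_const (hf.add_const B))
  · rw [measureReal_def, Real.volume_Ioc, ENNReal.toReal_ofReal (by linarith)]
    linarith

theorem abs_le_supNorm {E : Type*} {f : E → ℝ} {B : ℝ} (hB : ∀ x, |f x| ≤ B) (x : E) :
    |f x| ≤ supNorm f :=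
  le_ciSup (f := fun x => |f x|) ⟨B, by rintro _ ⟨y, rfl⟩; exact hB y⟩ x

theorem supNorm_nonneg {E : Type*} (f : E → ℝ) : 0 ≤ supNorm f :=
  Real.iSup_nonneg fun _ => abs_nonneg _

namespace Diffusion

variable {S : Set ℝ} {Ω : Type*} [MeasurableSpace Ω]

namespace IsUniformlyErgodic

variable {D : Diffusion S Ω} {π : Measure S}

/-- Exponential convergence of the semigroup on bounded functions. -/
theorem exists_abs_semigroup_sub_le (hD : D.IsUniformlyErgodic π) :
    ∃ C β : ℝ, 0 < β ∧ ∀ (f : S → ℝ) (B : ℝ), Measurable f → (∀ x, |f x| ≤ B) →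
      ∀ (t : ℝ) (x : S), 0 ≤ t →
        |D.semigroup f t x - ∫ y, f y ∂π| ≤ B * (C * Real.exp (-β * t)) := by
  obtain ⟨C, β, hβ, h⟩ := hD.decay
  have := hD.isProbabilityMeasure
  refine ⟨2 * C, β, hβ, fun f B hf hB t x ht => ?_⟩
  refine (abs_integral_sub_le_tvDist _ _ hf hB).trans ?_
  have h1 := h t.toNNReal x
  rw [Real.coe_toNNReal t ht] at h1
  have hB0 : 0 ≤ B := (abs_nonneg _).trans (hB x)
  nlinarith [mul_le_mul_of_nonneg_left h1 hB0]

theorem integrableOn_exp (c : ℝ) {β : ℝ} (hβ : 0 < β) :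
    IntegrableOn (fun t => c * Real.exp (-β * t)) (Set.Ioi 0) :=
  (integrableOn_exp_mul_Ioi (by linarith) 0).const_mul c

theorem integrableOn_semigroup_sub (hD : D.IsUniformlyErgodic π) {f : S → ℝ} (hf : Measurable f)
    {B : ℝ} (hB : ∀ x, |f x| ≤ B) (x : S) :
    IntegrableOn (fun t => D.semigroup f t x - ∫ y, f y ∂π) (Set.Ioi 0) := by
  obtain ⟨C, β, hβ, h⟩ := hD.exists_abs_semigroup_sub_le
  refine Integrable.mono' ((integrableOn_exp C hβ).const_mul B) ?_ ?_
  · exact (((D.measurable_uncurry_semigroup hf).comp measurable_prodMk_right).sub_const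
      _).aestronglyMeasurable
  · exact (ae_restrict_iff' measurableSet_Ioi).2
      (Filter.Eventually.of_forall fun t ht => h f B hf hB t x (le_of_lt ht))

/-- Uniformity in f makes the set defining `deviationNorm` bounded above; without this its `sSup`
would be the default value 0 and bound nothing. -/
theorem exists_abs_deviation_le (hD : D.IsUniformlyErgodic π) :
    ∃ K : ℝ, ∀ f : S → ℝ, Measurable f → (∀ x, |f x| ≤ 1) → ∀ x, |D.deviation π f x| ≤ K := by
  obtain ⟨C, β, hβ, h⟩ := hD.exists_abs_semigroup_sub_le
  refine ⟨∫ t in Set.Ioi 0, 1 * (C * Real.exp (-β * t)), fun f hf hB x => ?_⟩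
  rw [← Real.norm_eq_abs, deviation]
  refine norm_integral_le_of_norm_le ((integrableOn_exp C hβ).const_mul 1) ?_
  exact (ae_restrict_iff' measurableSet_Ioi).2
    (Filter.Eventually.of_forall fun t ht => h f 1 hf hB t x (le_of_lt ht))

theorem abs_deviation_le_deviationNorm (hD : D.IsUniformlyErgodic π) {f : S → ℝ}
    (hf : Measurable f) (hf1 : ∀ x, |f x| ≤ 1) (x : S) :
    |D.deviation π f x| ≤ D.deviationNorm π := by
  obtain ⟨K, hK⟩ := hD.exists_abs_deviation_le
  refine (abs_le_supNorm (hK f hf hf1) x).trans (le_csSup ⟨K, ?_⟩ ⟨f, hf, hf1, rfl⟩)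
  rintro _ ⟨φ, hφ, hφ1, rfl⟩
  have : Nonempty S := ⟨x⟩
  exact ciSup_le fun y => hK φ hφ hφ1 y

theorem abs_deviation_le (hD : D.IsUniformlyErgodic π) {f : S → ℝ} (hf : Measurable f) {B : ℝ}
    (hB : ∀ x, |f x| ≤ B) (x : S) : |D.deviation π f x| ≤ B * D.deviationNorm π := by
  have hsmul : ∀ c : ℝ, D.deviation π (fun y => c * f y) x = c * D.deviation π f x := by
    intro c
    simp only [deviation, integral_const_mul, ← mul_sub]
  rcases ((abs_nonneg _).trans (hB x)).eq_or_lt with h0 | hpos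
  · have hf0 : f = fun y => 0 * f y := by
      funext y
      have := hB y
      rw [← h0] at this
      simpa using this
    rw [hf0, hsmul, ← h0]
    simp
  · have h1 := hD.abs_deviation_le_deviationNorm (hf.const_mul B⁻¹) (fun y => by
      rw [abs_mul, abs_of_pos (inv_pos.2 hpos), inv_mul_le_one₀ hpos]
      exact hB y) x
    rw [hsmul, abs_mul, abs_of_pos (inv_pos.2 hpos), inv_mul_le_iff₀ hpos] at h1
    exact h1

theorem measurable_deviation {f : S → ℝ} (hf : Measurable f) :
    Measurable (D.deviation π f) := by
  have h : StronglyMeasurable fun p : S × ℝ => D.semigroup f p.2 p.1 - ∫ y, f y ∂π :=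
    (((D.measurable_uncurry_semigroup hf).comp measurable_swap).sub_const _).stronglyMeasurable
  exact (StronglyMeasurable.integral_prod_right' (ν := volume.restrict (Set.Ioi (0 : ℝ)))
    h).measurable

theorem integral_deviation (hD : D.IsUniformlyErgodic π) {f : S → ℝ} (hf : Measurable f) {B : ℝ}
    (hB : ∀ x, |f x| ≤ B) (ν : Measure S) [IsProbabilityMeasure ν] :
    ∫ x, D.deviation π f x ∂ν
      = ∫ t in Set.Ioi (0 : ℝ), (∫ x, D.semigroup f t x ∂ν - ∫ y, f y ∂π) := by
  obtain ⟨C, β, hβ, h⟩ := hD.exists_abs_semigroup_sub_le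
  have hm : Measurable fun p : S × ℝ => D.semigroup f p.2 p.1 - ∫ y, f y ∂π :=
    ((D.measurable_uncurry_semigroup hf).comp measurable_swap).sub_const _
  have hi : Integrable (fun p : S × ℝ => D.semigroup f p.2 p.1 - ∫ y, f y ∂π)
      (ν.prod (volume.restrict (Set.Ioi (0 : ℝ)))) := by
    refine Integrable.mono' (((integrableOn_exp C hβ).const_mul B).comp_snd ν)
      hm.aestronglyMeasurable ?_
    have h0 : ∀ᵐ t : ℝ ∂(volume.restrict (Set.Ioi (0 : ℝ))), 0 < t :=
      ae_restrict_mem measurableSet_Ioi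
    have h1 := Measure.quasiMeasurePreserving_snd (μ := ν)
      (ν := volume.restrict (Set.Ioi (0 : ℝ))) |>.ae h0
    filter_upwards [h1] with p hp
    exact h f B hf hB p.2 p.1 hp.le
  calc ∫ x, D.deviation π f x ∂ν
      = ∫ x, (∫ t in Set.Ioi (0 : ℝ), (D.semigroup f t x - ∫ y, f y ∂π)) ∂ν := rfl
    _ = ∫ t in Set.Ioi (0 : ℝ), ∫ x, (D.semigroup f t x - ∫ y, f y ∂π) ∂ν :=
        integral_integral_swap hi
    _ = _ := by
        refine integral_congr_ae (Filter.Eventually.of_forall fun t => ?_)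
        have hi : Integrable (fun x => D.semigroup f t x) ν := integrable_of_measurable_of_abs_le
          ((D.measurable_uncurry_semigroup hf).comp measurable_prodMk_left)
          fun x => D.abs_semigroup_le hB t x
        simp only
        rw [integral_sub hi (integrable_const _)]
        simp

/-- Centring allows Q♯ to be applied a second time, to Q♯f, without a mean to subtract. -/
theorem integral_deviation_stationary (hD : D.IsUniformlyErgodic π) {f : S → ℝ}
    (hf : Measurable f) {B : ℝ} (hB : ∀ x, |f x| ≤ B) : ∫ x, D.deviation π f x ∂π = 0 := by
  have := hD.isProbabilityMeasure
  rw [hD.integral_deviation hf hB]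
  have h : ∀ t : ℝ, ∫ x, D.semigroup f t x ∂π = ∫ y, f y ∂π := by
    intro t
    unfold semigroup
    rw [← integral_bind_kernel _ _ hf hB, (hD.invariant _).def]
  simp [h]

/-- Applying P^s to Q♯f shifts time by s and leaves the tail of the defining integral over (s, ∞).
This form of the Poisson equation does not require Q♯f to lie in the domain of a generator. -/
theorem deviation_eq_add_semigroup_deviation (hD : D.IsUniformlyErgodic π) {f : S → ℝ}
    (hf : Measurable f) {B : ℝ} (hB : ∀ x, |f x| ≤ B) {s : ℝ} (hs : 0 ≤ s) (x : S) :
    D.deviation π f x = (∫ t in (0 : ℝ)..s, (D.semigroup f t x - ∫ y, f y ∂π))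
      + D.semigroup (D.deviation π f) s x := by
  have hi := hD.integrableOn_semigroup_sub hf hB x
  have h1 : D.semigroup (D.deviation π f) s x
      = ∫ t in Set.Ioi s, (D.semigroup f t x - ∫ y, f y ∂π) := by
    unfold semigroup
    rw [hD.integral_deviation hf hB]
    have h2 : ∀ t ∈ Set.Ioi (0 : ℝ),
        ∫ y, D.semigroup f t y ∂(D.P s.toNNReal x) - ∫ y, f y ∂π
          = (fun t => D.semigroup f t x - ∫ y, f y ∂π) (t + s) := by
      intro t ht
      have := D.semigroup_semigroup hf hB hs (le_of_lt ht) x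
      rw [add_comm] at this
      simp only [← this]
      rfl
    have h3 := (measurePreserving_add_right volume s).setIntegral_preimage_emb
      (measurableEmbedding_addRight s) (fun t => D.semigroup f t x - ∫ y, f y ∂π) (Set.Ioi s)
    rw [Set.preimage_add_const_Ioi, sub_self] at h3
    rw [setIntegral_congr_fun measurableSet_Ioi h2, h3]
    rfl
  rw [h1, intervalIntegral.integral_of_le hs]
  rw [← setIntegral_union (Set.Ioc_disjoint_Ioi le_rfl) measurableSet_Ioi
    (hi.mono_set Set.Ioc_subset_Ioi_self) (hi.mono_set (Set.Ioi_subset_Ioi hs)),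
    Set.Ioc_union_Ioi_eq_Ioi hs]
  rfl

theorem intervalIntegrable_semigroup {f : S → ℝ} (hf : Measurable f) {B : ℝ}
    (hB : ∀ x, |f x| ≤ B) (x : S) (a b : ℝ) :
    IntervalIntegrable (fun t => D.semigroup f t x) volume a b := by
  rw [intervalIntegrable_iff]
  have : IsFiniteMeasure (volume.restrict (Set.uIoc a b)) := ⟨by simp [Set.uIoc]⟩
  exact integrable_of_measurable_of_abs_le
    ((D.measurable_uncurry_semigroup hf).comp measurable_prodMk_right)
    fun t => D.abs_semigroup_le hB t x

theorem deviationNorm_nonneg (D : Diffusion S Ω) (π : Measure S) : 0 ≤ D.deviationNorm π :=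
  Real.sSup_nonneg fun _ ⟨_, _, _, h⟩ => h ▸ supNorm_nonneg _

/-- If `f` is nowhere much smaller than its stationary mean, neither is `Q♯ f`. -/
theorem neg_le_deviation (hD : D.IsUniformlyErgodic π) {f : S → ℝ} (hf : Measurable f)
    (hf1 : ∀ x, |f x| ≤ 1) {b : ℝ} (hb : ∀ x, ∫ y, f y ∂π - b ≤ f x) {T : ℝ} (hT : 0 < T) (x : S) :
    -(b * T / 2 + 2 * D.deviationNorm π ^ 2 / T) ≤ D.deviation π f x := by
  set m := ∫ y, f y ∂π
  set g := D.deviation π f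
  set Q := D.deviationNorm π
  have hgm : Measurable g := measurable_deviation hf
  have hgQ : ∀ y, |g y| ≤ Q := hD.abs_deviation_le_deviationNorm hf hf1
  have hlow : ∀ t y, m - b ≤ D.semigroup f t y := by
    intro t y
    have : ∫ _, (m - b) ∂(D.P t.toNNReal y) ≤ D.semigroup f t y :=
      integral_mono (integrable_const _) (integrable_of_measurable_of_abs_le hf hf1) hb
    simpa using this
  -- The Poisson equation on [0, s] costs at most bs; integrating over s in [0, T] gives the term
  -- bT²/2.
  have h1 : ∀ s ∈ Set.Icc 0 T, D.semigroup g s x - b * s ≤ g x := by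
    intro s hs
    have h2 := hD.deviation_eq_add_semigroup_deviation hf hf1 hs.1 x
    have h3 : ∫ t in (0 : ℝ)..s, (-b) ≤ ∫ t in (0 : ℝ)..s, (D.semigroup f t x - m) := by
      refine intervalIntegral.integral_mono_on hs.1 (by simp)
        ((intervalIntegrable_semigroup hf hf1 x _ _).sub (by simp)) fun t _ => ?_
      linarith [hlow t x]
    simp only [intervalIntegral.integral_const, smul_eq_mul] at h3
    change g x = _ + D.semigroup g s x at h2
    linarith
  have h2 : ∫ s in (0 : ℝ)..T, (D.semigroup g s x - b * s) ≤ ∫ s in (0 : ℝ)..T, g x :=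
    intervalIntegral.integral_mono_on hT.le
      ((intervalIntegrable_semigroup hgm hgQ x _ _).sub
        (Continuous.intervalIntegrable (by fun_prop) _ _)) (by simp) h1
  rw [intervalIntegral.integral_sub (intervalIntegrable_semigroup hgm hgQ x _ _)
    (Continuous.intervalIntegrable (by fun_prop) _ _), intervalIntegral.integral_const_mul,
    integral_id, intervalIntegral.integral_const] at h2
  -- Since π(g) = 0, the Poisson equation for g itself gives ∫₀ᵀ P^s g ds = Q♯g - P^T Q♯g, and both
  -- terms are at most Q² in absolute value.
  have h3 := hD.deviation_eq_add_semigroup_deviation hgm hgQ hT.le x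
  rw [show ∫ y, g y ∂π = 0 from hD.integral_deviation_stationary hf hf1] at h3
  simp only [sub_zero, smul_eq_mul] at h2 h3
  have h4 := hD.abs_deviation_le hgm hgQ
  have h5 := abs_le.1 (h4 x)
  have h6 := abs_le.1 (D.abs_semigroup_le h4 T x)
  have h7 : -(2 * Q ^ 2) - b * T ^ 2 / 2 ≤ T * g x := by nlinarith
  have h8 : -(b * T / 2 + 2 * Q ^ 2 / T) = (-(2 * Q ^ 2) - b * T ^ 2 / 2) / T := by
    field_simp
    ring
  rw [h8, div_le_iff₀ hT]
  linarith

end IsUniformlyErgodic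
end Diffusion

/-! ### Time integrals along paths and their exponentials -/

theorem intervalIntegrable_of_measurable_of_abs_le {f : ℝ → ℝ} (hf : Measurable f) {B : ℝ}
    (hB : ∀ x, |f x| ≤ B) (a b : ℝ) : IntervalIntegrable f volume a b := by
  rw [intervalIntegrable_iff]
  have : IsFiniteMeasure (volume.restrict (Set.uIoc a b)) := ⟨by simp [Set.uIoc]⟩
  exact integrable_of_measurable_of_abs_le hf hB

theorem integral_intervalIntegral_comm {α : Type*} [MeasurableSpace α] {μ : Measure α}
    [IsFiniteMeasure μ] {F : ℝ → α → ℝ} (hF : Measurable fun p : ℝ × α => F p.1 p.2) {B : ℝ}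
    (a b : ℝ) (hB : ∀ s ∈ Set.uIoc a b, ∀ ω, |F s ω| ≤ B) :
    ∫ ω, (∫ s in a..b, F s ω) ∂μ = ∫ s in a..b, ∫ ω, F s ω ∂μ := by
  have : IsFiniteMeasure (volume.restrict (Set.uIoc a b)) := ⟨by simp [Set.uIoc]⟩
  have hi : Integrable (fun p : ℝ × α => F p.1 p.2)
      ((volume.restrict (Set.uIoc a b)).prod μ) := by
    refine Integrable.of_bound hF.aestronglyMeasurable B ?_
    have h0 : ∀ᵐ s : ℝ ∂(volume.restrict (Set.uIoc a b)), s ∈ Set.uIoc a b :=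
      ae_restrict_mem measurableSet_uIoc
    filter_upwards [(Measure.quasiMeasurePreserving_fst (ν := μ)).ae h0] with p hp
    exact hB _ hp _
  simp only [intervalIntegral.intervalIntegral_eq_integral_uIoc, integral_smul]
  rw [integral_integral_swap (f := F) hi]

theorem measurable_intervalIntegral_path {α E : Type*} [MeasurableSpace α] [TopologicalSpace E]
    [TopologicalSpace.PseudoMetrizableSpace E] [MeasurableSpace E] [BorelSpace E] {Y : ℝ≥0 → α → E}
    (hc : ∀ ω, Continuous fun t => Y t ω) (hm : ∀ t, Measurable (Y t)) {c : E → ℝ}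
    (hcm : Measurable c) (a b : ℝ) :
    Measurable fun ω => ∫ r in a..b, c (Y r.toNNReal ω) := by
  have h : Measurable fun p : α × ℝ => c (Y p.2.toNNReal p.1) := by
    have hY : Measurable fun p : ℝ≥0 × α => Y p.1 p.2 :=
      measurable_uncurry_of_continuous_of_measurable hc hm
    exact hcm.comp (hY.comp
      ((measurable_real_toNNReal.comp measurable_snd).prodMk measurable_fst))
  simp only [intervalIntegral]
  exact (h.stronglyMeasurable.integral_prod_right'.measurable).sub
    (h.stronglyMeasurable.integral_prod_right'.measurable)

section ExponentialOfIntegral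

variable {a c : ℝ → ℝ} {K L : ℝ}

theorem abs_intervalIntegral_le (hc : ∀ s, |c s| ≤ K) (s t : ℝ) :
    |∫ r in s..t, c r| ≤ K * |t - s| := by
  rw [← Real.norm_eq_abs]
  exact intervalIntegral.norm_integral_le_of_norm_le_const fun r _ => hc r

theorem lipschitzWith_intervalIntegral (hcm : Measurable c) (hc : ∀ s, |c s| ≤ K) :
    LipschitzWith K.toNNReal fun t => ∫ r in (0 : ℝ)..t, c r := by
  have hK : 0 ≤ K := (abs_nonneg _).trans (hc 0)
  refine LipschitzWith.of_dist_le_mul fun s t => ?_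
  rw [Real.dist_eq, intervalIntegral.integral_interval_sub_left
    (intervalIntegrable_of_measurable_of_abs_le hcm hc _ _)
    (intervalIntegrable_of_measurable_of_abs_le hcm hc _ _), Real.coe_toNNReal _ hK, Real.dist_eq]
  exact abs_intervalIntegral_le hc t s

theorem continuous_exp_intervalIntegral (hcm : Measurable c) (hc : ∀ s, |c s| ≤ K) :
    Continuous fun t => Real.exp (∫ r in (0 : ℝ)..t, c r) :=
  Real.continuous_exp.comp (lipschitzWith_intervalIntegral hcm hc).continuous

/-- As c is only measurable, the exponential is differentiable merely almost everywhere; absolute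
continuity still permits the fundamental theorem of calculus and integration by parts. The
exponential is Lipschitz on the compact range of the inner integral. -/
theorem absolutelyContinuousOnInterval_exp_intervalIntegral (hcm : Measurable c)
    (hc : ∀ s, |c s| ≤ K) (t : ℝ) :
    AbsolutelyContinuousOnInterval (fun s => Real.exp (∫ r in (0 : ℝ)..s, c r)) 0 t := by
  have hK : 0 ≤ K := (abs_nonneg _).trans (hc 0)
  obtain ⟨M, hM⟩ := (Real.contDiff_exp (n := 1)).contDiffOn.exists_lipschitzOnWith (by decide)
    (convex_Icc (-(K * |t|)) (K * |t|)) isCompact_Icc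
  refine (hM.comp ((lipschitzWith_intervalIntegral hcm hc).lipschitzOnWith (s := Set.uIcc 0 t))
    fun s hs => ?_).absolutelyContinuousOnInterval
  rw [Set.mem_Icc, ← abs_le]
  refine (abs_intervalIntegral_le hc 0 s).trans (mul_le_mul_of_nonneg_left ?_ hK)
  have := Set.abs_sub_left_of_mem_uIcc hs
  simpa using this

theorem ae_hasDerivAt_intervalIntegral (hcm : Measurable c) (hc : ∀ s, |c s| ≤ K) :
    ∀ᵐ s, HasDerivAt (fun t => ∫ r in (0 : ℝ)..t, c r) (c s) s := by
  have h : LocallyIntegrable c volume := by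
    refine (locallyIntegrable_const K).mono hcm.aestronglyMeasurable ?_
    exact Filter.Eventually.of_forall fun s => (hc s).trans (le_abs_self K)
  filter_upwards [LocallyIntegrable.ae_hasDerivAt_integral h] with s hs
  exact hs 0

theorem intervalIntegral_mul_exp (hcm : Measurable c) (hc : ∀ s, |c s| ≤ K) (t : ℝ) :
    ∫ s in (0 : ℝ)..t, c s * Real.exp (∫ r in (0 : ℝ)..s, c r)
      = Real.exp (∫ r in (0 : ℝ)..t, c r) - 1 := by
  have h := (absolutelyContinuousOnInterval_exp_intervalIntegral hcm hc t).integral_deriv_eq_sub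
  simp only [intervalIntegral.integral_same, Real.exp_zero] at h
  rw [← h]
  refine intervalIntegral.integral_congr_ae ?_
  filter_upwards [ae_hasDerivAt_intervalIntegral hcm hc] with s hs _
  rw [hs.exp.deriv, mul_comm]

theorem intervalIntegral_mul_exp_add (hcm : Measurable c) (hc : ∀ s, |c s| ≤ K)
    (ham : Measurable a) (ha : ∀ s, |a s| ≤ L) (t : ℝ) :
    ∫ s in (0 : ℝ)..t, (a s * Real.exp (∫ r in (0 : ℝ)..s, c r)
        + (∫ r in (0 : ℝ)..s, a r) * (c s * Real.exp (∫ r in (0 : ℝ)..s, c r)))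
      = (∫ r in (0 : ℝ)..t, a r) * Real.exp (∫ r in (0 : ℝ)..t, c r) := by
  have hA : AbsolutelyContinuousOnInterval (fun s => ∫ r in (0 : ℝ)..s, a r) 0 t :=
    (lipschitzWith_intervalIntegral ham ha).lipschitzOnWith.absolutelyContinuousOnInterval
  have h := hA.integral_deriv_mul_eq_sub
    (absolutelyContinuousOnInterval_exp_intervalIntegral hcm hc t)
  simp only [intervalIntegral.integral_same, zero_mul, sub_zero] at h
  rw [← h]
  refine intervalIntegral.integral_congr_ae ?_
  filter_upwards [ae_hasDerivAt_intervalIntegral hcm hc,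
    ae_hasDerivAt_intervalIntegral ham ha] with s hs hs' _
  rw [hs.exp.deriv, hs'.deriv, mul_comm (c s)]

end ExponentialOfIntegral

/-! ### Dynkin's formula and the Feynman–Kac identity -/

namespace Diffusion

variable {S : Set ℝ} {Ω : Type*} [MeasurableSpace Ω]

theorem measurable_X_toNNReal (D : Diffusion S Ω) :
    Measurable fun p : ℝ × Ω => D.X p.1.toNNReal p.2 :=
  D.measurable_uncurry_X.comp
    ((measurable_real_toNNReal.comp measurable_fst).prodMk measurable_snd)

theorem measurable_comp_path (D : Diffusion S Ω) {c : S → ℝ} (hc : Measurable c) (ω : Ω) :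
    Measurable fun s : ℝ => c (D.X s.toNNReal ω) :=
  hc.comp (D.measurable_X_toNNReal.comp measurable_prodMk_right)

theorem measurable_filtration_intervalIntegral (D : Diffusion S Ω) {c : S → ℝ}
    (hc : Measurable c) {s : ℝ} (hs : 0 ≤ s) :
    Measurable[D.ℱ s.toNNReal] fun ω => ∫ r in (0 : ℝ)..s, c (D.X r.toNNReal ω) := by
  -- Capping time at s leaves the integral over [0, s] unchanged and makes every value of the
  -- process measurable for the σ-algebra at s.
  have h := @measurable_intervalIntegral_path Ω S (D.ℱ s.toNNReal) _ _ _ _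
    (fun r ω => D.X (min r s.toNNReal) ω)
    (fun ω => (D.continuous_paths ω).comp (continuous_id.min continuous_const))
    (fun r => (D.adapted _).mono (D.ℱ.mono (min_le_right r _)) le_rfl) c hc 0 s
  convert h using 2 with ω
  refine intervalIntegral.integral_congr fun r hr => ?_
  rw [Set.uIcc_of_le hs] at hr
  simp only [min_eq_left (Real.toNNReal_le_toNNReal hr.2)]

theorem measurable_uncurry_intervalIntegral (D : Diffusion S Ω) {c : S → ℝ}
    (hc : Measurable c) {K : ℝ} (hK : ∀ y, |c y| ≤ K) :
    Measurable fun p : ℝ × Ω => ∫ r in (0 : ℝ)..p.1, c (D.X r.toNNReal p.2) :=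
  measurable_uncurry_of_continuous_of_measurable
    (u := fun s ω => ∫ r in (0 : ℝ)..s, c (D.X r.toNNReal ω))
    (fun ω => (lipschitzWith_intervalIntegral (D.measurable_comp_path hc ω)
      fun _ => hK _).continuous)
    fun s => measurable_intervalIntegral_path D.continuous_paths D.measurable_X hc 0 s

/-- If `u - P^t u = ∫₀ᵗ P^s a ds` then `u(X_t) + ∫₀ᵗ a(X_s) ds` is a martingale; here tested
against a bounded variable measurable with respect to the past of `s`. -/
theorem integral_mul_dynkin (D : Diffusion S Ω) {u a : S → ℝ} (hu : Measurable u)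
    (ha : Measurable a) {U A : ℝ} (hU : ∀ y, |u y| ≤ U) (hA : ∀ y, |a y| ≤ A)
    (hdyn : ∀ t, 0 ≤ t → ∀ y,
      u y = (∫ s in (0 : ℝ)..t, D.semigroup a s y) + D.semigroup u t y)
    (x : S) {s t : ℝ} (hs : 0 ≤ s) (hst : s ≤ t) {ξ : Ω → ℝ}
    (hξ : Measurable[D.ℱ s.toNNReal] ξ) {K : ℝ} (hK : ∀ ω, |ξ ω| ≤ K) :
    ∫ ω, ξ ω * (u (D.X t.toNNReal ω) - u (D.X s.toNNReal ω)
      + ∫ r in s..t, a (D.X r.toNNReal ω)) ∂(D.law x) = 0 := by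
  have hξ' : Measurable ξ := hξ.mono (D.ℱ.le _) le_rfl
  have hXr : ∀ r : ℝ, Measurable (D.X r.toNNReal) := fun r => D.measurable_X _
  have hbd : ∀ {ζ : Ω → ℝ} {B : ℝ}, (∀ ω, |ζ ω| ≤ B) → ∀ ω, |ξ ω * ζ ω| ≤ K * B := by
    intro ζ B h ω
    rw [abs_mul]
    exact mul_le_mul (hK ω) (h ω) (abs_nonneg _) ((abs_nonneg _).trans (hK ω))
  have h1 : ∫ ω, ξ ω * (∫ r in s..t, a (D.X r.toNNReal ω)) ∂(D.law x)
      = ∫ ω, ξ ω * (∫ r in s..t, D.semigroup a (r - s) (D.X s.toNNReal ω)) ∂(D.law x) := by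
    simp only [← intervalIntegral.integral_const_mul]
    rw [integral_intervalIntegral_comm (B := K * A), integral_intervalIntegral_comm (B := K * A)]
    · refine intervalIntegral.integral_congr fun r hr => ?_
      rw [Set.uIcc_of_le hst] at hr
      exact D.integral_mul_comp_X x hs hr.1 hξ hK ha hA
    · exact (hξ'.comp measurable_snd).mul ((D.measurable_uncurry_semigroup ha).comp
        ((measurable_fst.sub_const s).prodMk ((hXr s).comp measurable_snd)))
    · exact fun r _ ω => hbd (fun ω => D.abs_semigroup_le hA _ _) ω
    · exact (hξ'.comp measurable_snd).mul (ha.comp D.measurable_X_toNNReal)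
    · exact fun r _ ω => hbd (fun ω => hA _) ω
  have h2 := D.integral_mul_comp_X x hs hst hξ hK hu hU
  have hint1 : Integrable (fun ω => ξ ω * u (D.X t.toNNReal ω)) (D.law x) :=
    integrable_of_measurable_of_abs_le (hξ'.mul (hu.comp (hXr t))) (hbd fun ω => hU _)
  have hint2 : Integrable (fun ω => ξ ω * u (D.X s.toNNReal ω)) (D.law x) :=
    integrable_of_measurable_of_abs_le (hξ'.mul (hu.comp (hXr s))) (hbd fun ω => hU _)
  have hint3 : Integrable (fun ω => ξ ω * ∫ r in s..t, a (D.X r.toNNReal ω)) (D.law x) :=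
    integrable_of_measurable_of_abs_le (hξ'.mul (measurable_intervalIntegral_path
      D.continuous_paths D.measurable_X ha s t))
      (hbd fun ω => abs_intervalIntegral_le (fun _ => hA _) s t)
  have hint4 : Integrable (fun ω => ξ ω * D.semigroup u (t - s) (D.X s.toNNReal ω)) (D.law x) :=
    integrable_of_measurable_of_abs_le (hξ'.mul (((D.measurable_uncurry_semigroup hu).comp
      measurable_prodMk_left).comp (hXr s))) (hbd fun ω => D.abs_semigroup_le hU _ _)
  simp only [mul_add, mul_sub]
  have hint12 : Integrable (fun ω => ξ ω * u (D.X t.toNNReal ω) - ξ ω * u (D.X s.toNNReal ω))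
      (D.law x) := hint1.sub hint2
  rw [integral_add hint12 hint3, integral_sub hint1 hint2, h1, h2]
  have h3 : ∀ ω, ξ ω * ∫ r in s..t, D.semigroup a (r - s) (D.X s.toNNReal ω)
      = ξ ω * u (D.X s.toNNReal ω) - ξ ω * D.semigroup u (t - s) (D.X s.toNNReal ω) := by
    intro ω
    rw [intervalIntegral.integral_comp_sub_right
      (fun v => D.semigroup a v (D.X s.toNNReal ω)), sub_self,
      hdyn (t - s) (sub_nonneg.2 hst) (D.X s.toNNReal ω)]
    ring
  simp only [h3]
  rw [integral_sub hint2 hint4]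
  ring

/-- The Feynman–Kac identity `𝔼_x [u(X_t) exp ∫₀ᵗ c(X_s) ds] = u(x)` for `c u = -𝒜 u`. -/
theorem integral_mul_exp_eq (D : Diffusion S Ω) {u a c : S → ℝ} (hu : Measurable u)
    (ha : Measurable a) (hc : Measurable c) {U A K : ℝ} (hU : ∀ y, |u y| ≤ U)
    (hA : ∀ y, |a y| ≤ A) (hK : ∀ y, |c y| ≤ K) (hacu : ∀ y, c y * u y = a y)
    (hdyn : ∀ t, 0 ≤ t → ∀ y,
      u y = (∫ s in (0 : ℝ)..t, D.semigroup a s y) + D.semigroup u t y)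
    (x : S) {t : ℝ} (ht : 0 ≤ t) :
    ∫ ω, u (D.X t.toNNReal ω) * Real.exp (∫ s in (0 : ℝ)..t, c (D.X s.toNNReal ω)) ∂(D.law x)
      = u x := by
  set Z : ℝ → Ω → ℝ := fun s ω => Real.exp (∫ r in (0 : ℝ)..s, c (D.X r.toNNReal ω))
  have hK0 : 0 ≤ K := (abs_nonneg _).trans (hK x)
  have hZm : Measurable fun p : ℝ × Ω => Z p.1 p.2 :=
    Real.measurable_exp.comp (D.measurable_uncurry_intervalIntegral hc hK)
  have hZb : ∀ s ∈ Set.Icc 0 t, ∀ ω, |Z s ω| ≤ Real.exp (K * t) := by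
    intro s hs ω
    rw [abs_of_pos (Real.exp_pos _)]
    refine Real.exp_le_exp.2 ((le_abs_self _).trans ((abs_intervalIntegral_le
      (c := fun r => c (D.X r.toNNReal ω)) (fun _ => hK _) 0 s).trans ?_))
    rw [sub_zero, abs_of_nonneg hs.1]
    exact mul_le_mul_of_nonneg_left hs.2 hK0
  -- With M_s = u(X_s) + ∫₀ˢ a(X_r) dr this is c(X_s) Z_s (M_t - M_s): a bounded variable from the
  -- past of s times a later martingale increment, so of mean zero. Integrating over s replaces
  -- stochastic calculus.
  set G : ℝ → Ω → ℝ := fun s ω => c (D.X s.toNNReal ω) * Z s ω *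
    (u (D.X t.toNNReal ω) - u (D.X s.toNNReal ω) + ∫ r in s..t, a (D.X r.toNNReal ω))
  have hsplit : ∀ s ω, ∫ r in s..t, a (D.X r.toNNReal ω)
      = (∫ r in (0 : ℝ)..t, a (D.X r.toNNReal ω)) - ∫ r in (0 : ℝ)..s, a (D.X r.toNNReal ω) := by
    intro s ω
    have hi := intervalIntegrable_of_measurable_of_abs_le (D.measurable_comp_path ha ω)
      (fun _ => hA _)
    rw [intervalIntegral.integral_interval_sub_left (hi _ _) (hi _ _)]
  have hGsplit : ∀ s ω, G s ω = c (D.X s.toNNReal ω) * Z s ω *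
      (u (D.X t.toNNReal ω) - u (D.X s.toNNReal ω) + ((∫ r in (0 : ℝ)..t, a (D.X r.toNNReal ω))
        - ∫ r in (0 : ℝ)..s, a (D.X r.toNNReal ω))) := by
    intro s ω
    rw [← hsplit]
  have hGm : Measurable fun p : ℝ × Ω => G p.1 p.2 := by
    have hAm := D.measurable_uncurry_intervalIntegral ha hA
    simp only [hGsplit]
    exact ((hc.comp D.measurable_X_toNNReal).mul hZm).mul
      ((((hu.comp (D.measurable_X _)).comp measurable_snd).sub
        (hu.comp D.measurable_X_toNNReal)).add
        ((hAm.comp (measurable_const.prodMk measurable_snd)).sub hAm))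
  have hGb : ∀ s ∈ Set.uIoc 0 t, ∀ ω, |G s ω| ≤ K * Real.exp (K * t) * (U + U + A * t) := by
    intro s hs ω
    rw [Set.uIoc_of_le ht] at hs
    rw [abs_mul, abs_mul]
    have h1 := abs_intervalIntegral_le (c := fun r => a (D.X r.toNNReal ω)) (fun _ => hA _) s t
    have hA0 : 0 ≤ A := (abs_nonneg _).trans (hA x)
    have h2 : A * |t - s| ≤ A * t := by
      rw [abs_of_nonneg (sub_nonneg.2 hs.2)]
      exact mul_le_mul_of_nonneg_left (by linarith [hs.1]) hA0
    refine mul_le_mul (mul_le_mul (hK _) (hZb s ⟨hs.1.le, hs.2⟩ ω) (abs_nonneg _) hK0) ?_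
      (abs_nonneg _) (by positivity)
    refine (abs_add_le _ _).trans (add_le_add ((abs_sub _ _).trans
      (add_le_add (hU _) (hU _))) (h1.trans h2))
  have hzero : ∫ ω, (∫ s in (0 : ℝ)..t, G s ω) ∂(D.law x) = 0 := by
    rw [integral_intervalIntegral_comm hGm 0 t hGb]
    have h0 : ∀ s ∈ Set.uIcc 0 t, ∫ ω, G s ω ∂(D.law x) = 0 := by
      intro s hs
      rw [Set.uIcc_of_le ht] at hs
      refine D.integral_mul_dynkin hu ha hU hA hdyn x hs.1 hs.2 (K := K * Real.exp (K * t))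
        ?_ fun ω => ?_
      · exact (hc.comp (D.adapted _)).mul
          (Real.measurable_exp.comp (D.measurable_filtration_intervalIntegral hc hs.1))
      · rw [abs_mul]
        exact mul_le_mul (hK _) (hZb s hs ω) (abs_nonneg _) hK0
    rw [intervalIntegral.integral_congr h0]
    simp
  have hpath : ∀ ω, ∫ s in (0 : ℝ)..t, G s ω = u (D.X t.toNNReal ω) * Z t ω
      - u (D.X t.toNNReal ω) - ∫ r in (0 : ℝ)..t, a (D.X r.toNNReal ω) := by
    intro ω
    have hcm := D.measurable_comp_path hc ω
    have ham := D.measurable_comp_path ha ω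
    have h1 := intervalIntegral_mul_exp hcm (fun _ => hK _) t
    have h2 := intervalIntegral_mul_exp_add hcm (fun _ => hK _) ham (fun _ => hA _) t
    have hZc : Continuous fun s => Z s ω := continuous_exp_intervalIntegral hcm fun _ => hK _
    have hAc : Continuous fun s => ∫ r in (0 : ℝ)..s, a (D.X r.toNNReal ω) :=
      (lipschitzWith_intervalIntegral ham fun _ => hA _).continuous
    have hci := intervalIntegrable_of_measurable_of_abs_le hcm (fun _ => hK _) 0 t
    have hai := intervalIntegrable_of_measurable_of_abs_le ham (fun _ => hA _) 0 t
    -- The relation c u = a turns the term c Z u into a Z, so that the subtracted bracket is the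
    -- derivative of (∫₀ˢ a) Z_s.
    have hG : ∀ s, G s ω = (u (D.X t.toNNReal ω) + ∫ r in (0 : ℝ)..t, a (D.X r.toNNReal ω))
        * (c (D.X s.toNNReal ω) * Z s ω)
        - (a (D.X s.toNNReal ω) * Z s ω
          + (∫ r in (0 : ℝ)..s, a (D.X r.toNNReal ω)) * (c (D.X s.toNNReal ω) * Z s ω)) := by
      intro s
      rw [hGsplit, ← hacu (D.X s.toNNReal ω)]
      ring
    have hi1 : IntervalIntegrable (fun s => c (D.X s.toNNReal ω) * Z s ω) volume 0 t :=
      hci.mul_continuousOn hZc.continuousOn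
    have hi2 : IntervalIntegrable (fun s => a (D.X s.toNNReal ω) * Z s ω
          + (∫ r in (0 : ℝ)..s, a (D.X r.toNNReal ω)) * (c (D.X s.toNNReal ω) * Z s ω))
        volume 0 t :=
      (hai.mul_continuousOn hZc.continuousOn).add (hi1.continuousOn_mul hAc.continuousOn)
    simp only [hG]
    rw [intervalIntegral.integral_sub (hi1.const_mul _) hi2, intervalIntegral.integral_const_mul]
    simp only [Z] at h1 h2 ⊢
    rw [h1, h2]
    ring
  simp only [hpath] at hzero
  have hint1 : Integrable (fun ω => u (D.X t.toNNReal ω) * Z t ω) (D.law x) := by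
    refine integrable_of_measurable_of_abs_le (B := U * Real.exp (K * t))
      ((hu.comp (D.measurable_X _)).mul (hZm.comp measurable_prodMk_left)) fun ω => ?_
    rw [abs_mul]
    exact mul_le_mul (hU _) (hZb t ⟨ht, le_rfl⟩ ω) (abs_nonneg _) ((abs_nonneg _).trans (hU x))
  have hint2 : Integrable (fun ω => u (D.X t.toNNReal ω)) (D.law x) :=
    integrable_of_measurable_of_abs_le (hu.comp (D.measurable_X _)) fun ω => hU _
  have hint3 : Integrable (fun ω => ∫ r in (0 : ℝ)..t, a (D.X r.toNNReal ω)) (D.law x) :=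
    integrable_of_measurable_of_abs_le (measurable_intervalIntegral_path
      D.continuous_paths D.measurable_X ha 0 t) fun ω =>
      abs_intervalIntegral_le (fun _ => hA _) 0 t
  have hA2 : ∫ ω, (∫ r in (0 : ℝ)..t, a (D.X r.toNNReal ω)) ∂(D.law x)
      = ∫ r in (0 : ℝ)..t, D.semigroup a r x := by
    rw [integral_intervalIntegral_comm (F := fun r ω => a (D.X r.toNNReal ω))
      (ha.comp D.measurable_X_toNNReal) 0 t (fun _ _ _ => hA _)]
    simp only [D.semigroup_eq ha]
  have hint12 : Integrable (fun ω => u (D.X t.toNNReal ω) * Z t ω - u (D.X t.toNNReal ω))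
      (D.law x) := hint1.sub hint2
  rw [integral_sub hint12 hint3, integral_sub hint1 hint2, hA2,
    ← D.semigroup_eq hu] at hzero
  rw [hdyn t ht x]
  linarith

end Diffusion

/-! ### Numerical inequalities -/

section RealInequalities

/-- The fourth-order Taylor polynomial of the exponential suffices: its product with the quadratic
exceeds 1 by r² times a polynomial that is nonnegative for r ≥ 0. Since 12/11 > 1, the quadratic
stays at least 1/12, whereas (1 - r)² would vanish at r = 1. -/
theorem exp_neg_le_quadratic {r : ℝ} (h0 : 0 ≤ r) :
    Real.exp (-(2 * r + 6 / 5 * r ^ 2 + 2 / 5 * r ^ 3)) ≤ 1 - 2 * r + 12 / 11 * r ^ 2 := by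
  set x := 2 * r + 6 / 5 * r ^ 2 + 2 / 5 * r ^ 3 with hx
  have hx0 : 0 ≤ x := by positivity
  have hD : 0 < 1 - 2 * r + 12 / 11 * r ^ 2 := by nlinarith [sq_nonneg (r - 11 / 12)]
  have hexp : 1 + x + x ^ 2 / 2 + x ^ 3 / 6 + x ^ 4 / 24 ≤ Real.exp x := by
    have := Real.sum_le_exp_of_nonneg hx0 5
    simp only [Finset.sum_range_succ, Finset.sum_range_zero, Nat.factorial] at this
    norm_num at this
    linarith
  -- The polynomial of `h'` with coefficients rounded down and the r⁵ term dropped.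
  have hR : 0 ≤ 16 / 55 - 14 / 165 * r - 52 / 275 * r ^ 2 - 284 / 825 * r ^ 3
      - 42 / 125 * r ^ 4 + 11 / 20 * r ^ 6 + 16 / 25 * r ^ 7 + 11 / 25 * r ^ 8 := by
    nlinarith [sq_nonneg (r ^ 3 - 0.45), mul_nonneg h0 (sq_nonneg (r ^ 3 - 0.45)),
      sq_nonneg (r ^ 4 - 0.35), sq_nonneg (r ^ 2 - 0.3), mul_nonneg h0 (sq_nonneg (r - 0.55)),
      sq_nonneg (r - 0.42)]
  have hpoly : 1 ≤ (1 - 2 * r + 12 / 11 * r ^ 2)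
      * (1 + x + x ^ 2 / 2 + x ^ 3 / 6 + x ^ 4 / 24) := by
    have h : (1 - 2 * r + 12 / 11 * r ^ 2) * (1 + x + x ^ 2 / 2 + x ^ 3 / 6 + x ^ 4 / 24) - 1
        = r ^ 2 * ((16 / 55 - 14 / 165 * r - 52 / 275 * r ^ 2 - 284 / 825 * r ^ 3
          - 1382 / 4125 * r ^ 4 + 388 / 4125 * r ^ 5 + 3794 / 6875 * r ^ 6 + 13312 / 20625 * r ^ 7
          + 612 / 1375 * r ^ 8) + (832 / 4125 * r ^ 9 + 254 / 4125 * r ^ 10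
          + 244 / 20625 * r ^ 11 + 8 / 6875 * r ^ 12)) := by
      rw [hx]
      ring
    have h' : 0 ≤ 16 / 55 - 14 / 165 * r - 52 / 275 * r ^ 2 - 284 / 825 * r ^ 3
        - 1382 / 4125 * r ^ 4 + 388 / 4125 * r ^ 5 + 3794 / 6875 * r ^ 6 + 13312 / 20625 * r ^ 7
        + 612 / 1375 * r ^ 8 := by
      linarith [pow_nonneg h0 4, pow_nonneg h0 5, pow_nonneg h0 6, pow_nonneg h0 7,
        pow_nonneg h0 8]
    rw [← sub_nonneg, h]
    positivity
  rw [Real.exp_neg, inv_le_comm₀ (Real.exp_pos x) hD]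
  refine le_trans ?_ hexp
  rw [inv_le_iff_one_le_mul₀' hD]
  exact hpoly

/-- For N = t + 1 and s = 2Q the right side is (t+1)(2Q+1)² - 8Qt, the room left in the Chernoff
exponent for the terms of order r² and r³. -/
theorem quadratic_le_of_one_add_le_mul {N r s : ℝ} (hr : r < 1) (hs : 0 ≤ s)
    (hN : 1 + s / 2 ≤ N * (1 - r)) :
    2 * s ^ 2 * (6 / 5 + 2 / 5 * r) ≤ N * (s - 1) ^ 2 + 4 * s := by
  have h1 : 0 < 1 - r := sub_pos.2 hr
  have key : 0 ≤ (1 + s / 2) * (s - 1) ^ 2 + (1 - r) * (4 * s - 2 * s ^ 2 * (6 / 5 + 2 / 5 * r)) := by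
    -- Up to 5/4 the term 4s alone dominates, even at r = 1; beyond it, completing the square in r
    -- leaves a cubic in s that is positive there.
    rcases le_total s (5 / 4) with h | h
    · have h2 : 0 ≤ 4 * s - 2 * s ^ 2 * (6 / 5 + 2 / 5 * r) := by
        have h3 : s ^ 2 * (6 / 5 + 2 / 5 * r) ≤ s ^ 2 * (8 / 5) :=
          mul_le_mul_of_nonneg_left (by linarith) (sq_nonneg s)
        nlinarith
      positivity
    · have h2 : (1 + s / 2) * (s - 1) ^ 2 + (1 - r) * (4 * s - 2 * s ^ 2 * (6 / 5 + 2 / 5 * r))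
          = 4 / 5 * (s * r + s - 5 / 2) ^ 2 + ((s - 13 / 5) ^ 2 * (s / 2 - 3 / 5) + 7 / 125) := by
        ring
      rw [h2]
      have h3 : 0 ≤ s / 2 - 3 / 5 := by linarith
      positivity
  have h2 : (1 + s / 2) * (s - 1) ^ 2 ≤ N * (1 - r) * (s - 1) ^ 2 :=
    mul_le_mul_of_nonneg_right hN (sq_nonneg _)
  by_contra! hcon
  nlinarith [mul_lt_mul_of_pos_right hcon h1]

/-- The pointwise inequality behind the choice of the supersolution. -/
theorem mul_le_of_quadratic_bounds {θ Q q w v y : ℝ} (hθ : 0 < θ) (hQ : 0 ≤ Q)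
    (hq1 : q ≤ 1) (hr : Q * θ < q) (hw : w ≤ 1)
    (hD : 0 < 1 - 2 * (Q * θ) * (1 - Q * θ / (2 * q)))
    (hv1 : θ * (1 - Q * θ / (2 * q)) ≤ v)
    (hv2 : v * (1 - 2 * w * (Q * θ) * (1 - Q * θ / (2 * q))) ≤ θ * (1 - Q * θ / (2 * q)))
    (hy1 : -(2 * (1 - q)) ≤ y) (hy2 : y ≤ 2 * q) :
    θ * y ≤ Q * θ ^ 2 + y * v := by
  set r := Q * θ with hrdef
  have hr0 : 0 ≤ r := by positivity
  have hq0 : 0 < q := hr0.trans_lt hr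
  set ρ := 1 - r / (2 * q) with hρ
  have hρq : 2 * q * ρ = 2 * q - r := by rw [hρ]; field_simp
  have hρ0 : 0 < ρ := by nlinarith
  -- For v ≤ θ the worst case is y = 2q with v = θρ, and ρ is chosen to make it an equality.
  rcases le_total v θ with h | h
  · have h1 : y * (θ - v) ≤ 2 * q * (θ - v) := mul_le_mul_of_nonneg_right hy2 (by linarith)
    have h2 : 2 * q * (θ - v) ≤ 2 * q * (θ - θ * ρ) :=
      mul_le_mul_of_nonneg_left (by linarith) (by linarith)
    have h3 : 2 * q * (θ - θ * ρ) = Q * θ ^ 2 := by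
      linear_combination (-θ) * hρq + θ * hrdef
    linarith
  -- For v ≥ θ the worst case is y = -2(1 - q) with v as large as w = 1 permits; after clearing
  -- denominators the claim is r(r + 1 - 2q)² ≥ 0.
  · have h1 : -y * (v - θ) ≤ 2 * (1 - q) * (v - θ) :=
      mul_le_mul_of_nonneg_right (by linarith) (by linarith)
    have hv0 : 0 < v := hθ.trans_le h
    have h2 : v * (1 - 2 * r * ρ) ≤ θ * ρ := by
      have h4 : w * (r * ρ * v) ≤ 1 * (r * ρ * v) :=
        mul_le_mul_of_nonneg_right hw (by positivity)
      nlinarith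
    have h3 : 2 * (1 - q) * (v - θ) ≤ r * θ := by
      have h5 : 0 ≤ q * (r * (1 - 2 * r * ρ) - 2 * (1 - q) * (ρ - (1 - 2 * r * ρ))) := by
        have h6 : q * (r * (1 - 2 * r * ρ) - 2 * (1 - q) * (ρ - (1 - 2 * r * ρ)))
            = r * (r + 1 - 2 * q) ^ 2 := by
          linear_combination (-r ^ 2 - (1 - q) - 2 * (1 - q) * r) * hρq
        rw [h6]
        positivity
      have h7 : 2 * (1 - q) * (ρ - (1 - 2 * r * ρ)) ≤ r * (1 - 2 * r * ρ) := by
        have := nonneg_of_mul_nonneg_right h5 hq0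
        linarith
      by_contra! hcon
      have h8 := mul_lt_mul_of_pos_right hcon hD
      have h9 : 2 * (1 - q) * (v * (1 - 2 * r * ρ)) ≤ 2 * (1 - q) * (θ * ρ) :=
        mul_le_mul_of_nonneg_left h2 (by linarith)
      have h10 := mul_le_mul_of_nonneg_left h7 hθ.le
      nlinarith
    have h11 : r * θ = Q * θ ^ 2 := by rw [hrdef]; ring
    linarith

/-- The Chernoff exponent at the optimal parameter. -/
theorem chernoff_exponent_le {t e Q q : ℝ} (ht : 0 < t) (hQ : 0 ≤ Q) (hq1 : q ≤ 1)
    (he : e ≤ 2 * q) (hlt : 2 * Q < t * e) {θ : ℝ}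
    (hθ : θ = 4 * (t * e - 2 * Q) / ((t + 1) * (2 * Q + 1) ^ 2)) :
    0 < θ ∧ Q * θ < q ∧
    2 * (Q * θ) + 6 / 5 * (Q * θ) ^ 2 + 2 / 5 * (Q * θ) ^ 3 + (Q * θ ^ 2 * t - θ * (t * e))
      ≤ -2 * (t * e - 2 * Q) ^ 2 / ((t + 1) * (2 * Q + 1) ^ 2) := by
  have ha : 0 < t * e - 2 * Q := by linarith
  have hV : 0 < (t + 1) * (2 * Q + 1) ^ 2 := by positivity
  have hθ0 : 0 < θ := by rw [hθ]; positivity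
  have hθV : θ * ((t + 1) * (2 * Q + 1) ^ 2) = 4 * (t * e - 2 * Q) := by
    rw [hθ]; field_simp
  have hte : t * e ≤ t * (2 * q) := mul_le_mul_of_nonneg_left he ht.le
  have hq0 : 0 < q := by
    by_contra! hcon
    nlinarith
  -- From 8Q ≤ (2Q+1)² the left side is at most (te - 2Q)/2. This yields both Qθ < q and the
  -- hypothesis 1 + Q ≤ (t+1)(1 - Qθ) of the slack inequality.
  have hrN : Q * θ * (t + 1) ≤ q * t - Q := by
    have h1 : Q * θ * (t + 1) * (2 * Q + 1) ^ 2 ≤ (q * t - Q) * (2 * Q + 1) ^ 2 := by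
      have h2 : Q * θ * (t + 1) * (2 * Q + 1) ^ 2 = Q * (4 * (t * e - 2 * Q)) := by
        rw [← hθV]; ring
      rw [h2]
      have h3 : 0 ≤ (t * e - 2 * Q) * (2 * Q - 1) ^ 2 := by positivity
      have h4 : (t * e - 2 * Q) * (2 * Q + 1) ^ 2 ≤ (t * (2 * q) - 2 * Q) * (2 * Q + 1) ^ 2 :=
        mul_le_mul_of_nonneg_right (by linarith) (sq_nonneg _)
      nlinarith
    exact le_of_mul_le_mul_right h1 (by positivity)
  have hr : Q * θ < q := by
    by_contra! hcon
    have := mul_le_mul_of_nonneg_right hcon (by linarith : (0 : ℝ) ≤ t + 1)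
    nlinarith
  refine ⟨hθ0, hr, ?_⟩
  have hslack := quadratic_le_of_one_add_le_mul (N := t + 1) (r := Q * θ) (s := 2 * Q)
    (hr.trans_le hq1) (by positivity) (by nlinarith)
  have hslack' := mul_le_mul_of_nonneg_right hslack (by positivity : 0 ≤ θ ^ 2 / 8)
  -- The right side is the quadratic in θ whose minimiser is the chosen θ.
  have hmain : 2 * (Q * θ) + 6 / 5 * (Q * θ) ^ 2 + 2 / 5 * (Q * θ) ^ 3
      + (Q * θ ^ 2 * t - θ * (t * e))
      ≤ -θ * (t * e - 2 * Q) + θ * (θ * ((t + 1) * (2 * Q + 1) ^ 2)) / 8 := by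
    nlinarith
  refine hmain.trans (le_of_eq ?_)
  rw [hθV, hθ]
  field_simp
  ring

end RealInequalities


/-! ### The exponential tail bound -/

namespace Diffusion

variable {S : Set ℝ} {Ω : Type*} [MeasurableSpace Ω]

/-- A positive supersolution of the Feynman–Kac equation bounds the tail of `∫₀ᵗ a(X_s) ds`. -/
theorem measureReal_le_of_supersolution (D : Diffusion S Ω) {u a : S → ℝ} (hu : Measurable u)
    (ha : Measurable a) {A lo hi : ℝ} (hlo : 0 < lo) (hulo : ∀ y, lo ≤ u y)
    (huhi : ∀ y, u y ≤ hi) (hA : ∀ y, |a y| ≤ A)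
    (hdyn : ∀ t, 0 ≤ t → ∀ y,
      u y = (∫ s in (0 : ℝ)..t, D.semigroup a s y) + D.semigroup u t y)
    {θ Λ : ℝ} (hθ : 0 ≤ θ) (hsup : ∀ y, θ * a y ≤ Λ + a y * (u y)⁻¹)
    (x : S) {t : ℝ} (ht : 0 ≤ t) (R : ℝ) :
    (D.law x).real {ω | R ≤ ∫ s in (0 : ℝ)..t, a (D.X s.toNNReal ω)}
      ≤ hi / lo * Real.exp (Λ * t - θ * R) := by
  have hupos : ∀ y, 0 < u y := fun y => hlo.trans_le (hulo y)
  have hU : ∀ y, |u y| ≤ hi := fun y => by rw [abs_of_pos (hupos y)]; exact huhi y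
  have hcm : Measurable fun y => a y * (u y)⁻¹ := ha.mul hu.inv
  have hcK : ∀ y, |a y * (u y)⁻¹| ≤ A * lo⁻¹ := by
    intro y
    rw [abs_mul, abs_of_pos (inv_pos.2 (hupos y))]
    exact mul_le_mul (hA y) (inv_anti₀ hlo (hulo y)) (inv_pos.2 (hupos y)).le
      ((abs_nonneg _).trans (hA y))
  have hFK := D.integral_mul_exp_eq hu ha hcm hU hA hcK
    (fun y => by rw [mul_assoc, inv_mul_cancel₀ (hupos y).ne', mul_one]) hdyn x ht
  set h : Ω → ℝ := fun ω => u (D.X t.toNNReal ω)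
    * Real.exp (∫ s in (0 : ℝ)..t, a (D.X s.toNNReal ω) * (u (D.X s.toNNReal ω))⁻¹)
  have hint : Integrable h (D.law x) := by
    -- A non-integrable function has integral 0 by convention, but this integral equals u(x) > 0.
    by_contra hcon
    rw [integral_undef hcon] at hFK
    exact (hupos x).ne hFK
  have hnn : 0 ≤ᵐ[D.law x] h := Filter.Eventually.of_forall fun ω =>
    mul_nonneg (hupos _).le (Real.exp_pos _).le
  have hmarkov := mul_meas_ge_le_integral_of_nonneg hnn hint (lo * Real.exp (θ * R - Λ * t))
  rw [hFK] at hmarkov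
  have hsub : {ω | R ≤ ∫ s in (0 : ℝ)..t, a (D.X s.toNNReal ω)}
      ⊆ {ω | lo * Real.exp (θ * R - Λ * t) ≤ h ω} := by
    intro ω hω
    have hai := intervalIntegrable_of_measurable_of_abs_le (D.measurable_comp_path ha ω)
      (fun _ => hA _) 0 t
    have hci := intervalIntegrable_of_measurable_of_abs_le (D.measurable_comp_path hcm ω)
      (fun _ => hcK _) 0 t
    have h1 : ∫ s in (0 : ℝ)..t, (θ * a (D.X s.toNNReal ω) - Λ)
        ≤ ∫ s in (0 : ℝ)..t, a (D.X s.toNNReal ω) * (u (D.X s.toNNReal ω))⁻¹ :=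
      intervalIntegral.integral_mono_on ht ((hai.const_mul θ).sub (by simp)) hci
        fun s _ => by linarith [hsup (D.X s.toNNReal ω)]
    rw [intervalIntegral.integral_sub (hai.const_mul θ) (by simp),
      intervalIntegral.integral_const_mul, intervalIntegral.integral_const, sub_zero,
      smul_eq_mul] at h1
    have h2 : θ * R ≤ θ * ∫ s in (0 : ℝ)..t, a (D.X s.toNNReal ω) :=
      mul_le_mul_of_nonneg_left hω hθ
    exact mul_le_mul (hulo _) (Real.exp_le_exp.2 (by linarith)) (Real.exp_pos _).le (hupos _).le
  have hmono : (D.law x).real {ω | R ≤ ∫ s in (0 : ℝ)..t, a (D.X s.toNNReal ω)}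
      ≤ (D.law x).real {ω | lo * Real.exp (θ * R - Λ * t) ≤ h ω} := measureReal_mono hsub
  have hpos : 0 < lo * Real.exp (θ * R - Λ * t) := by positivity
  have hle := (mul_le_mul_of_nonneg_left hmono hpos.le).trans (hmarkov.trans (huhi x))
  have hexp : Real.exp (Λ * t - θ * R) = (Real.exp (θ * R - Λ * t))⁻¹ := by
    rw [← Real.exp_neg]
    ring_nf
  rw [hexp, div_mul_eq_mul_div, ← div_eq_mul_inv, div_div, le_div_iff₀ (by positivity)]
  linarith

namespace IsUniformlyErgodic

variable {D : Diffusion S Ω} {π : Measure S}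

/-- The exponential bound with the lower bound `-(2 w - 1) ‖Q♯‖` on the deviation as parameter. -/
theorem measureReal_le_of_neg_le_deviation (hD : D.IsUniformlyErgodic π) {f : S → ℝ}
    (hf : Measurable f) (hf1 : ∀ x, |f x| ≤ 1) {q w θ : ℝ} (hq : 2 * q = 1 - ∫ y, f y ∂π)
    (hq1 : q ≤ 1) (hθ : 0 < θ) (hr : D.deviationNorm π * θ < q) (hw : w ≤ 1)
    (hg : ∀ x, -((2 * w - 1) * D.deviationNorm π) ≤ D.deviation π f x)
    (x : S) {t : ℝ} (ht : 0 ≤ t) (R : ℝ) :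
    (D.law x).real {ω | R ≤ ∫ s in (0 : ℝ)..t, (f (D.X s.toNNReal ω) - ∫ y, f y ∂π)}
      ≤ (1 - 2 * w * (D.deviationNorm π * θ) * (1 - D.deviationNorm π * θ / (2 * q)))⁻¹
        * Real.exp (D.deviationNorm π * θ ^ 2 * t - θ * R) := by
  set Q := D.deviationNorm π with hQdef
  set m := ∫ y, f y ∂π
  set g := D.deviation π f
  have hQ : 0 ≤ Q := deviationNorm_nonneg D π
  have hr0 : 0 ≤ Q * θ := by positivity
  have hq0 : 0 < q := hr0.trans_lt hr
  set ρ := 1 - Q * θ / (2 * q) with hρ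
  have hρq : 2 * q * ρ = 2 * q - Q * θ := by rw [hρ]; field_simp
  have hρ0 : 0 < ρ := by nlinarith
  have hD1 : 0 < 1 - 2 * (Q * θ) * ρ := by
    have h1 : q * (1 - 2 * (Q * θ) * ρ) = (q - Q * θ) ^ 2 + q * (1 - q) := by
      linear_combination (-(Q * θ)) * hρq
    have h2 : 0 < q * (1 - 2 * (Q * θ) * ρ) := by
      rw [h1]
      have := pow_pos (sub_pos.2 hr) 2
      have := mul_nonneg hq0.le (sub_nonneg.2 hq1)
      linarith
    exact pos_of_mul_pos_right h2 hq0.le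
  have hDw : 0 < 1 - 2 * w * (Q * θ) * ρ := by
    have : w * (Q * θ * ρ) ≤ 1 * (Q * θ * ρ) := mul_le_mul_of_nonneg_right hw (by positivity)
    linarith
  have hgm : Measurable g := measurable_deviation hf
  have hgQ : ∀ y, |g y| ≤ Q := hD.abs_deviation_le_deviationNorm hf hf1
  -- Since g ≤ Q, this k gives u ≤ (θρ)⁻¹; the parameter w enters only the lower bound.
  set k := (θ * ρ)⁻¹ - Q with hk
  have hlo : 0 < (1 - 2 * w * (Q * θ) * ρ) / (θ * ρ) := by positivity
  have hloeq : (1 - 2 * w * (Q * θ) * ρ) / (θ * ρ) = k - (2 * w - 1) * Q := by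
    rw [hk]
    field_simp
    ring
  have hulo : ∀ y, (1 - 2 * w * (Q * θ) * ρ) / (θ * ρ) ≤ g y + k := fun y => by
    rw [hloeq]; linarith [hg y]
  have huhi : ∀ y, g y + k ≤ (θ * ρ)⁻¹ := fun y => by
    rw [hk]; linarith [(abs_le.1 (hgQ y)).2]
  have hm1 : |m| ≤ 1 := by
    have := hD.isProbabilityMeasure
    exact abs_integral_le_of_abs_le hf1
  have key := D.measureReal_le_of_supersolution (u := fun y => g y + k) (a := fun y => f y - m)
    (A := 2) (hgm.add_const k) (hf.sub_const m) hlo hulo huhi (fun y => ?_)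
    (fun s hs y => ?_) hθ.le (Λ := Q * θ ^ 2) (fun y => ?_) x ht R
  · refine key.trans (le_of_eq ?_)
    congr 1
    field_simp
  · exact (abs_sub _ _).trans (by linarith [hf1 y])
  · have h1 := hD.deviation_eq_add_semigroup_deviation hf hf1 hs y
    rw [D.semigroup_add_const hgm hgQ]
    simp only [D.semigroup_sub_const hf hf1]
    change g y = _ + D.semigroup g s y at h1
    linarith
  · have hu : 0 < g y + k := hlo.trans_le (hulo y)
    have hfy := abs_le.1 (hf1 y)
    refine mul_le_of_quadratic_bounds hθ hQ hq1 hr hw hD1 ?_ ?_ (by linarith) (by linarith)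
    · rw [← hρ, le_inv_comm₀ (by positivity) hu]
      exact huhi y
    · rw [← hρ, inv_mul_le_iff₀ hu, ← div_le_iff₀ (by positivity)]
      exact hulo y

/-- The concentration bound for functions bounded by one. -/
theorem measureReal_le_of_abs_le_one (hD : D.IsUniformlyErgodic π) {f : S → ℝ}
    (hf : Measurable f) (hf1 : ∀ x, |f x| ≤ 1) {e t : ℝ} (ht : 0 < t)
    (hlt : 2 * D.deviationNorm π < t * e) (x : S) :
    (D.law x).real {ω | t * e ≤ ∫ s in (0 : ℝ)..t, (f (D.X s.toNNReal ω) - ∫ y, f y ∂π)}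
      ≤ Real.exp (-2 * (t * e - 2 * D.deviationNorm π) ^ 2
          / ((t + 1) * (2 * D.deviationNorm π + 1) ^ 2)) := by
  have hQ : 0 ≤ D.deviationNorm π := deviationNorm_nonneg D π
  have := hD.isProbabilityMeasure
  set m := ∫ y, f y ∂π
  have hm1 := abs_le.1 (abs_integral_le_of_abs_le (μ := π) hf1)
  change -1 ≤ m ∧ m ≤ 1 at hm1
  obtain ⟨q, hq⟩ : ∃ q, 2 * q = 1 - m := ⟨(1 - m) / 2, by ring⟩
  have hq1 : q ≤ 1 := by linarith
  rcases lt_or_ge (2 * q) e with he | he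
  · have hempty : {ω | t * e ≤ ∫ s in (0 : ℝ)..t, (f (D.X s.toNNReal ω) - m)} = ∅ := by
      refine Set.eq_empty_of_forall_notMem fun ω hω => ?_
      have h1 : ∫ s in (0 : ℝ)..t, (f (D.X s.toNNReal ω) - m) ≤ ∫ s in (0 : ℝ)..t, 2 * q := by
        refine intervalIntegral.integral_mono_on ht.le ((intervalIntegrable_of_measurable_of_abs_le
          (D.measurable_comp_path hf ω) (fun _ => hf1 _) 0 t).sub (by simp)) (by simp)
          fun s _ => ?_
        linarith [(abs_le.1 (hf1 (D.X s.toNNReal ω))).2]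
      rw [intervalIntegral.integral_const, sub_zero, smul_eq_mul] at h1
      have h2 : t * (2 * q) < t * e := mul_lt_mul_of_pos_left he ht
      have h3 : t * e ≤ ∫ s in (0 : ℝ)..t, (f (D.X s.toNNReal ω) - m) := hω
      linarith
    rw [hempty, measureReal_empty]
    exact (Real.exp_pos _).le
  obtain ⟨θ, hθ⟩ : ∃ θ, θ = 4 * (t * e - 2 * D.deviationNorm π)
      / ((t + 1) * (2 * D.deviationNorm π + 1) ^ 2) := ⟨_, rfl⟩
  obtain ⟨hθ0, hr, hexp⟩ := chernoff_exponent_le ht hQ hq1 he hlt hθ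
  set Q := D.deviationNorm π
  have hr0 : 0 ≤ Q * θ := by positivity
  have hq0 : 0 < q := hr0.trans_lt hr
  -- For q ≤ 11/12 the trivial w = 1 works, because the quadratic has leading coefficient 1/q ≥
  -- 12/11. For larger q, w = 10/11 leaves a surplus of at least (2/11) r(1 - r).
  obtain ⟨w, hw, hg, hquad⟩ : ∃ w ≤ (1 : ℝ), (∀ y, -((2 * w - 1) * Q) ≤ D.deviation π f y) ∧
      1 - 2 * (Q * θ) + 12 / 11 * (Q * θ) ^ 2
        ≤ 1 - 2 * w * (Q * θ) * (1 - Q * θ / (2 * q)) := by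
    have hgQ := hD.abs_deviation_le_deviationNorm hf hf1
    rcases le_total q (11 / 12) with h | h
    · refine ⟨1, le_rfl, fun y => by linarith [(abs_le.1 (hgQ y)).1], ?_⟩
      have h1 : 12 / 11 ≤ 1 / q := by rw [div_le_div_iff₀ (by norm_num) hq0]; linarith
      have h2 : 1 - 2 * 1 * (Q * θ) * (1 - Q * θ / (2 * q))
          = 1 - 2 * (Q * θ) + 1 / q * (Q * θ) ^ 2 := by
        field_simp
        ring
      rw [h2]
      linarith [mul_le_mul_of_nonneg_right h1 (sq_nonneg (Q * θ))]
    · refine ⟨10 / 11, by norm_num, fun y => ?_, ?_⟩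
      · rcases hQ.eq_or_lt with h0 | hpos
        · have := (abs_le.1 (hgQ y)).1
          change -Q ≤ _ at this
          change (0 : ℝ) = Q at h0
          rw [← h0] at this ⊢
          linarith
        -- T = 5Q is close to the optimal 2Q/√b at the extreme value b = 1/6; it gives 5/12 + 2/5 =
        -- 49/60 < 9/11 = 2w - 1.
        · have h1 := hD.neg_le_deviation hf hf1 (b := 2 * (1 - q)) (fun y => by
            change m - _ ≤ _
            linarith [(abs_le.1 (hf1 y)).1]) (T := 5 * Q) (by positivity) y
          change -(2 * (1 - q) * (5 * Q) / 2 + 2 * Q ^ 2 / (5 * Q)) ≤ _ at h1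
          have h2 : 2 * (1 - q) * (5 * Q) / 2 + 2 * Q ^ 2 / (5 * Q)
              = (5 * (1 - q) + 2 / 5) * Q := by
            field_simp
          rw [h2] at h1
          have h3 : (5 * (1 - q) + 2 / 5) * Q ≤ (2 * (10 / 11) - 1) * Q :=
            mul_le_mul_of_nonneg_right (by linarith) hQ
          linarith
      · have h1 : 1 ≤ 1 / q := by rw [le_div_iff₀ hq0]; linarith
        have h2 : 1 - 2 * (10 / 11) * (Q * θ) * (1 - Q * θ / (2 * q))
            = 1 - 20 / 11 * (Q * θ) + 10 / 11 * (1 / q * (Q * θ) ^ 2) := by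
          field_simp
          ring
        rw [h2]
        have h3 := mul_le_mul_of_nonneg_right h1 (sq_nonneg (Q * θ))
        nlinarith [mul_nonneg hr0 (by linarith : 0 ≤ 1 - Q * θ)]
  have hlow := (exp_neg_le_quadratic hr0).trans hquad
  have hratio : (1 - 2 * w * (Q * θ) * (1 - Q * θ / (2 * q)))⁻¹
      ≤ Real.exp (2 * (Q * θ) + 6 / 5 * (Q * θ) ^ 2 + 2 / 5 * (Q * θ) ^ 3) := by
    rw [Real.exp_neg] at hlow
    exact inv_le_of_inv_le₀ (Real.exp_pos _) hlow
  refine (hD.measureReal_le_of_neg_le_deviation hf hf1 hq hq1 hθ0 hr hw hg x ht.le _).trans ?_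
  refine (mul_le_mul_of_nonneg_right hratio (Real.exp_pos _).le).trans ?_
  rw [← Real.exp_add]
  exact Real.exp_le_exp.2 hexp

end IsUniformlyErgodic
end Diffusion
end

/-! ### Rescaling to functions of norm one -/

theorem theorem1 {S : Set ℝ} {Ω : Type*} [MeasurableSpace Ω] (D : Diffusion S Ω)
    (π : Measure S) (hD : D.IsUniformlyErgodic π)
    (f : S → ℝ) (hf : Measurable f) (hfb : ∃ B : ℝ, ∀ x, |f x| ≤ B)
    (ε : ℝ) (hε : 0 < ε) (t : ℝ) (ht : 2 * supNorm f * D.deviationNorm π / ε < t) (x : S) :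
    (D.law x).real {ω | ε ≤ 1 / t * (∫ s in (0 : ℝ)..t, f (D.X s.toNNReal ω)) - ∫ y, f y ∂π}
      ≤ Real.exp (-2 * (t * ε - 2 * supNorm f * D.deviationNorm π) ^ 2 /
          ((t + 1) * supNorm f ^ 2 * (2 * D.deviationNorm π + 1) ^ 2)) := by
  obtain ⟨B, hB⟩ := hfb
  have hQ := Diffusion.IsUniformlyErgodic.deviationNorm_nonneg D π
  have hfF := abs_le_supNorm hB
  have hlt : 2 * supNorm f * D.deviationNorm π < t * ε := (div_lt_iff₀ hε).1 ht
  rcases (supNorm_nonneg f).eq_or_lt with h0 | hF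
  -- For f = 0 division by zero makes the exponent 0, so the bound is the trivial 1.
  · rw [← h0]
    simp only [ne_eq, OfNat.ofNat_ne_zero, not_false_eq_true, zero_pow, mul_zero, zero_mul,
      div_zero, Real.exp_zero]
    exact measureReal_le_one
  set F := supNorm f
  have ht0 : 0 < t := lt_of_le_of_lt (by positivity) ht
  have hset : {ω | ε ≤ 1 / t * (∫ s in (0 : ℝ)..t, f (D.X s.toNNReal ω)) - ∫ y, f y ∂π}
      = {ω | t * (ε / F) ≤ ∫ s in (0 : ℝ)..t,
          (F⁻¹ * f (D.X s.toNNReal ω) - ∫ y, F⁻¹ * f y ∂π)} := by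
    ext ω
    have hi := intervalIntegrable_of_measurable_of_abs_le (D.measurable_comp_path hf ω)
      (fun _ => hB _) 0 t
    have h1 : ∫ s in (0 : ℝ)..t, (F⁻¹ * f (D.X s.toNNReal ω) - ∫ y, F⁻¹ * f y ∂π)
        = t / F * (1 / t * (∫ s in (0 : ℝ)..t, f (D.X s.toNNReal ω)) - ∫ y, f y ∂π) := by
      rw [intervalIntegral.integral_sub (hi.const_mul _) (by simp),
        intervalIntegral.integral_const_mul, intervalIntegral.integral_const, integral_const_mul,
        sub_zero, smul_eq_mul]
      field_simp
    rw [Set.mem_ofPred_eq, Set.mem_ofPred_eq, h1, show t * (ε / F) = t / F * ε by ring]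
    exact (mul_le_mul_iff_right₀ (by positivity)).symm
  have key := hD.measureReal_le_of_abs_le_one (f := fun y => F⁻¹ * f y) (e := ε / F)
    (hf.const_mul _) (fun y => by
      rw [abs_mul, abs_of_pos (inv_pos.2 hF), inv_mul_le_one₀ hF]
      exact hfF y) ht0 (by
      rw [← mul_div_assoc, lt_div_iff₀ hF]
      linarith) x
  rw [hset]
  refine key.trans (le_of_eq ?_)
  congr 1
  field_simp
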